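/- Let $\tau_E:E\to M$ be a Lie algebroid of rank $n$ over a smooth $m$-manifold, with anchor $\rho$ and bracket $[\![\cdot,\cdot]\!]$. Let $\mathcal T^{\tau_E}E=\{(e',v_e)\in E\times T_eE:\rho(e')=T\tau_E(v_e)\}$ be its $E$-tangent bundle (prolongation), a Lie algebroid over $E$, let $E^{(2)}=\{v_e\in T_eE:\rho(e)=T\tau_E(v_e)\}\subset\mathcal T^{\tau_E}E$ be the set of admissible elements, and let $L:E^{(2)}\to\mathbb R$ be smooth. Put $W_0=E^{(2)}\times_E(\mathcal T^{\tau_E}E)^*$ with projections $\nu:W_0\to E$ and $\pi_2:W_0\to(\mathcal T^{\tau_E}E)^*$, let $H_{W_0}(\check\alpha,\alpha^*)=\langle\alpha^*,\check\alpha\rangle-L(\check\alpha)$, and let $\Omega_0=(\mathcal T\pi_2,\pi_2)^*\Omega$ be the presymplectic section on the prolongation $\mathcal T^{\nu}\mathcal T^{\tau_E}E$ (anchor $\rho^\nu$, differential $d$), where $\Omega=-d\lambda$ is the canonical symplectic section of the prolongation of $\mathcal T^{\tau_E}E$ over its dual, $\lambda$ being the Liouville section. Take a chart $(x^i)$ of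 $M$ and a local frame $(e_A)$ of $E$ over its domain, with $\rho(e_A)=\rho^i_A\,\partial/\partial x^i$ and $[\![e_A,e_B]\!]=\mathcal C^C_{AB}e_C$, and the induced coordinates $(x^i,y^A)$ on $E$, $(x^i,y^A,z^A)$ on $E^{(2)}$ and $(x^i,y^A,p_A,\bar p_A,z^A)$ on $W_0$. In these coordinates $X$ solves $i_X\Omega_0=dH_{W_0}$ at a point of $W_0$ if and only if that point satisfies $\bar p_A=\partial L/\partial z^A$ and, in the adapted basis, the components of $X$ are: $e_A^{(1)}$-component $y^A$, $e_A^{(2)}$-component $z^A$, $p_A$-component $\rho^i_A\frac{\partial L}{\partial x^i}-\mathcal C^C_{AB}p_Cy^B$, $\bar p_A$-component $-p_A+\frac{\partial L}{\partial y^A}$, and arbitrary $z^A$-component. Hence the integral curves of $\rho^\nu(X)$, for any solution $X$ along a subset of $W_0$, satisfy $$\dot x^i=\rho^i_Ay^A,\quad \dot y^A=z^A,\quad \dot p_A=\rho^i_A\frac{\partial L}{\partial x^i}-\mathcal C^C_{AB}p_Cy^B,\quad \dot{\bar p}_A=-p_A+\frac{\partial L}{\partial y^A},\quad \bar p_A=\frac{\partial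 L}{\partial z^A},$$ and a smooth curve in $W_0$ satisfies these equations if and only if it is an integral curve of $\rho^\nu(X)$ for some solution $X$ along it. A smooth curve $(x,y,z)$ in $E^{(2)}$ has smooth momenta $(p,\bar p)$ such that these equations hold if and only if $\dot x^i=\rho^i_Ay^A$, $z^A=\dot y^A$ and $$0=\frac{d^2}{dt^2}\frac{\partial L}{\partial z^A}+\mathcal C^C_{AB}y^B\frac{d}{dt}\frac{\partial L}{\partial z^C}-\frac{d}{dt}\frac{\partial L}{\partial y^A}-\mathcal C^C_{AB}y^B\frac{\partial L}{\partial y^C}+\rho^i_A\frac{\partial L}{\partial x^i}$$ (the second-order Euler–Lagrange equations on $E$); the momenta are then $\bar p_A=\frac{\partial L}{\partial z^A}$ and $p_A=\frac{\partial L}{\partial y^A}-\frac{d}{dt}\frac{\partial L}{\partial z^A}$. Suppose moreover that, over the domain $U$ of the chart, $E$ is the Atiyah algebroid $T(U\times G)/G$ of a locally trivialized principal bundle, where the Lie group $G$ acts by left translations and has Lie algebra $\mathfrak g$ with basis $(\xi_A)$ and structure constants $c^C_{AB}$. Let $\mathcal A$ be a principal connection with $\mathcal A(\partial/\partial x^i)|_{(x,e)}=\mathcal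 A^A_i\xi_A$ and curvature coefficients $\mathcal B^A_{ij}=\partial_i\mathcal A^A_j-\partial_j\mathcal A^A_i-c^A_{BC}\mathcal A^B_i\mathcal A^C_j$, and take the frame $\hat e_i=\frac{\partial}{\partial x^i}-\mathcal A^A_i\overleftarrow{\xi_A}$, $\hat e_B=\overleftarrow{\xi_B}$ ($\overleftarrow{\xi}$ the left-invariant vector field), with coordinates $(x^i,y^i,\bar y^B,\dot y^i,\dot{\bar y}^B)$ on $E^{(2)}$. Then the second-order Euler–Lagrange equations are equivalent to the second-order Lagrange–Poincaré equations: $\dot x^i=y^i$, the last coordinates are the derivatives of $y^i,\bar y^B$, and $$\frac{\partial L}{\partial x^j}-\frac{d}{dt}\frac{\partial L}{\partial y^j}+\frac{d^2}{dt^2}\frac{\partial L}{\partial\dot y^j}=-\Big(\frac{d}{dt}\frac{\partial L}{\partial\dot{\bar y}^A}-\frac{\partial L}{\partial\bar y^A}\Big)\big(\mathcal B^A_{ij}y^i+c^A_{DB}\mathcal A^B_j\bar y^D\big),$$ $$\frac{d^2}{dt^2}\frac{\partial L}{\partial\dot{\bar y}^B}-\frac{d}{dt}\frac{\partial L}{\partial\bar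 y^B}=\Big(\frac{d}{dt}\frac{\partial L}{\partial\dot{\bar y}^A}-\frac{\partial L}{\partial\bar y^A}\Big)\big(c^A_{DB}\bar y^D-c^A_{DB}\mathcal A^D_iy^i\big).$$ If $\dim G=0$ (in particular $G=\{e\}$), the latter are equivalent to the classical second-order Euler–Lagrange equations $0=\frac{d^2}{dt^2}\frac{\partial L}{\partial\dot y^i}-\frac{d}{dt}\frac{\partial L}{\partial y^i}+\frac{\partial L}{\partial x^i}$ with $y=\dot x$; if $\dim M=0$ (in particular when $M$ is a point, so that the principal bundle is $G$ itself), they are equivalent to the second-order Euler–Poincaré equations $0=\frac{d^2}{dt^2}\frac{\partial L}{\partial\dot{\bar y}^A}+c^C_{AB}\bar y^B\frac{d}{dt}\frac{\partial L}{\partial\dot{\bar y}^C}-\frac{d}{dt}\frac{\partial L}{\partial\bar y^A}-c^C_{AB}\bar y^B\frac{\partial L}{\partial\bar y^C}$. -/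

import Mathlib

open Set Bundle
open scoped Manifold ContDiff Topology

noncomputable section

/-! ### Lie algebroids -/

/-- A Lie algebroid structure on the smooth vector bundle `V → M` (model fibre `F`, base of
dimension `m`): an `ℝ`-Lie bracket on the smooth sections and a smooth vector bundle morphism
`ρ : V → TM` (the anchor) satisfying the Leibniz rule. -/
structure LieAlgebroid (m : ℕ) {M : Type*} [TopologicalSpace M]
    [ChartedSpace (EuclideanSpace ℝ (Fin m)) M] [IsManifold (𝓡 m) ∞ M]
    (F : Type*) [NormedAddCommGroup F] [NormedSpace ℝ F]
    (V : M → Type*) [TopologicalSpace (TotalSpace F V)]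
    [∀ x, AddCommGroup (V x)] [∀ x, Module ℝ (V x)] [∀ x, TopologicalSpace (V x)]
    [FiberBundle F V] [VectorBundle ℝ F V] where
  /-- the anchor map, fibre by fibre -/
  anchor : ∀ x : M, V x →L[ℝ] TangentSpace (𝓡 m) x
  anchor_smooth : ContMDiff ((𝓡 m).prod 𝓘(ℝ, F)) (𝓡 m).tangent ∞
    (fun e : TotalSpace F V => (⟨e.proj, anchor e.proj e.snd⟩ : TangentBundle (𝓡 m) M))
  /-- the bracket on the space of smooth sections -/
  bracket : Cₛ^∞⟮𝓡 m; F, V⟯ → Cₛ^∞⟮𝓡 m; F, V⟯ → Cₛ^∞⟮𝓡 m; F, V⟯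
  bracket_add : ∀ X Y Z, bracket X (Y + Z) = bracket X Y + bracket X Z
  bracket_smul : ∀ (c : ℝ) X Y, bracket X (c • Y) = c • bracket X Y
  bracket_skew : ∀ X Y, bracket X Y = -bracket Y X
  jacobi : ∀ X Y Z,
    bracket X (bracket Y Z) + bracket Z (bracket X Y) + bracket Y (bracket Z X) = 0
  /-- `⟦X, f Y⟧ = f ⟦X, Y⟧ + ρ(X)(f) Y`; the section `Z` is `f Y` -/
  leibniz : ∀ (X Y Z : Cₛ^∞⟮𝓡 m; F, V⟯) (f : M → ℝ), ContMDiff (𝓡 m) 𝓘(ℝ, ℝ) ∞ f →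
    (∀ x, Z x = f x • Y x) → ∀ x : M,
      bracket X Z x = f x • bracket X Y x +
        (show ℝ from mfderiv (𝓡 m) 𝓘(ℝ, ℝ) f x (anchor x (X x))) • Y x

/-! ### Lie algebroids in a trivialisation, and their prolongations -/

/-- A Lie algebroid on the trivial bundle `dom × F → dom` over an open subset of a normed space `H`,
given by its anchor and by the brackets of the *constant* sections (for the standard frame of
`F = ℝⁿ` these are the structure functions `ρ^i_A` and `C^C_{AB}`). -/
structure LocalAlgebroid (H F : Type*) [NormedAddCommGroup H] [NormedSpace ℝ H]
    [NormedAddCommGroup F] [NormedSpace ℝ F] where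
  dom : Set H
  anchor : H → F →ₗ[ℝ] H
  struct : H → F →ₗ[ℝ] F →ₗ[ℝ] F

namespace LocalAlgebroid

section General

variable {H F : Type*} [NormedAddCommGroup H] [NormedSpace ℝ H]
  [NormedAddCommGroup F] [NormedSpace ℝ F]

/-- The bracket of two sections: the extension by the Leibniz rule of the bracket of constant
sections. -/
def bracket (A : LocalAlgebroid H F) (σ τ : H → F) (x : H) : F :=
  A.struct x (σ x) (τ x) + fderiv ℝ τ x (A.anchor x (σ x)) - fderiv ℝ σ x (A.anchor x (τ x))

/-- The algebroid differential of a function, `df(a) = ρ(a)(f)`. -/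
def dZero (A : LocalAlgebroid H F) (f : H → ℝ) (x : H) (a : F) : ℝ :=
  fderiv ℝ f x (A.anchor x a)

/-- The algebroid differential of a `1`-section,
`dθ(X, Y) = ρ(X)(θ(Y)) - ρ(Y)(θ(X)) - θ⟦X, Y⟧`. The right-hand side is tensorial, and its value at
`(a, b)` over `x` is computed with the constant sections `a`, `b`. -/
def dOne (A : LocalAlgebroid H F) (θ : H → F → ℝ) (x : H) (a b : F) : ℝ :=
  A.dZero (fun x' => θ x' b) x a - A.dZero (fun x' => θ x' a) x b
    - θ x (A.bracket (fun _ => a) (fun _ => b) x)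

/-- The fibre over `p = (x, k)` of the prolongation of `A` over a (trivial) fibration
`f : P = dom × K → dom`, i.e. the vectors `(a, v) ∈ F × T_pP` with `ρ(a) = T_pf(v)`. -/
def prolongFiber (A : LocalAlgebroid H F) (K : Type*) [NormedAddCommGroup K] [NormedSpace ℝ K]
    (p : H × K) : Submodule ℝ (F × (H × K)) :=
  LinearMap.ker ((A.anchor p.1).comp (LinearMap.fst ℝ F (H × K)) -
    (LinearMap.fst ℝ H K).comp (LinearMap.snd ℝ F (H × K)))

/-- Adapted coordinates on that fibre: `(a, (ρ(a), u)) ↔ (a, u)`. -/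
def prolongFiberEquiv (A : LocalAlgebroid H F) (K : Type*) [NormedAddCommGroup K] [NormedSpace ℝ K]
    (p : H × K) : (F × K) ≃ₗ[ℝ] A.prolongFiber K p where
  toFun ξ := ⟨(ξ.1, (A.anchor p.1 ξ.1, ξ.2)), by simp [prolongFiber]⟩
  map_add' ξ η := by ext <;> simp
  map_smul' c ξ := by ext <;> simp
  invFun v := (v.1.1, v.1.2.2)
  left_inv ξ := rfl
  right_inv v := by
    have h : A.anchor p.1 v.1.1 = v.1.2.1 := by
      have := v.2
      simpa [prolongFiber, sub_eq_zero] using this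
    ext <;> simp [h]

/-- The prolongation Lie algebroid of `A` over the fibration `dom × K → dom`, in adapted coordinates
of its fibres. The anchor is the projection `(a, v) ↦ v` to the tangent space, here
`(a, u) ↦ (ρ(a), u)`; the bracket is the one for which projectable sections satisfy
`⟦(X, V), (Y, W)⟧ = (⟦X, Y⟧, [V, W])`: the sections `(a, ρ(a))` with `a` constant bracket as in `A`,
and the brackets with constant vertical sections vanish. -/
def prolong (A : LocalAlgebroid H F) (K : Type*) [NormedAddCommGroup K] [NormedSpace ℝ K] :
    LocalAlgebroid (H × K) (F × K) where
  dom := A.dom ×ˢ univ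
  anchor p := (A.anchor p.1).prodMap LinearMap.id
  struct p := LinearMap.mk₂ ℝ (fun ξ η => (A.struct p.1 ξ.1 η.1, 0))
    (by intro ξ ξ' η; simp) (by intro c ξ η; simp) (by intro ξ η η'; simp) (by intro c ξ η; simp)

/-- The Liouville `1`-section `λ(α)(a, v) = ⟨α, a⟩` of the prolongation of `A` over the dual bundle
`dom × F* → dom`. -/
def liouville (q : H × (F →L[ℝ] ℝ)) (ξ : F × (F →L[ℝ] ℝ)) : ℝ := q.2 ξ.1

/-- The canonical symplectic section `Ω = -dλ` of the prolongation of `A` over its dual bundle. -/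
def canonicalSymplectic (A : LocalAlgebroid H F) (q : H × (F →L[ℝ] ℝ))
    (ξ η : F × (F →L[ℝ] ℝ)) : ℝ :=
  -(A.prolong (F →L[ℝ] ℝ)).dOne liouville q ξ η

/-! ### The second-order Skinner–Rusk formalism

For `E` over the coordinate domain, with coordinates `(x, y)`:
* `𝒯E = E.tangent` is the prolongation of `E` over `τ_E : E → M`, a Lie algebroid over `E`;
* `E⁽²⁾ = {(e, (e', v)) ∈ 𝒯E | e' = e}` has coordinates `((x, y), z)`, standing for the element
  `(y, (ρ(x) y, z))` of the fibre of `𝒯E` over `(x, y)`;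
* `W₀ = E⁽²⁾ ×_E (𝒯E)*` has points `((x, y), (z, α))` with `α ∈ (𝒯E)*_{(x, y)}`. -/

/-- The `E`-tangent bundle `𝒯E`. -/
def tangent (A : LocalAlgebroid H F) : LocalAlgebroid (H × F) (F × F) := A.prolong F

/-- The inclusion of the admissible elements `E⁽²⁾` in the total space of `𝒯E`. -/
def admIncl (q : (H × F) × F) : (H × F) × (F × F) := (q.1, (q.1.2, q.2))

variable (H F) in
/-- `W₀ = E⁽²⁾ ×_E (𝒯E)*`. -/
abbrev PontryaginSpace : Type _ := (H × F) × (F × ((F × F) →L[ℝ] ℝ))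

variable (F) in
/-- Fibres of the prolongation of `𝒯E` over `ν : W₀ → E`, in adapted coordinates. -/
abbrev PontryaginFiber : Type _ := (F × F) × (F × ((F × F) →L[ℝ] ℝ))

/-- The prolongation of `𝒯E` over the projection `ν : W₀ → E`. -/
def pontryagin (A : LocalAlgebroid H F) :
    LocalAlgebroid (PontryaginSpace H F) (PontryaginFiber F) :=
  A.tangent.prolong (F × ((F × F) →L[ℝ] ℝ))

/-- `π₂ : W₀ → (𝒯E)*`. -/
def piTwo (w : PontryaginSpace H F) : (H × F) × ((F × F) →L[ℝ] ℝ) := (w.1, w.2.2)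

/-- `𝒯π₂ = (Id, Tπ₂)`. -/
def piTwoProlonged (X : PontryaginFiber F) : (F × F) × ((F × F) →L[ℝ] ℝ) := (X.1, X.2.2)

/-- The presymplectic section `Ω₀ = (𝒯π₂, π₂)*Ω`, with `Ω` the canonical symplectic section of the
prolongation of `𝒯E` over its dual. -/
def presymplectic (A : LocalAlgebroid H F) (w : PontryaginSpace H F) (X Y : PontryaginFiber F) : ℝ :=
  A.tangent.canonicalSymplectic (piTwo w) (piTwoProlonged X) (piTwoProlonged Y)

/-- The Pontryagin Hamiltonian `H(α̌, α*) = ⟨α*, α̌⟩ - L(α̌)`. -/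
def pontryaginHamiltonian (L : (H × F) × F → ℝ) (w : PontryaginSpace H F) : ℝ :=
  w.2.2 (admIncl (w.1, w.2.1)).2 - L (w.1, w.2.1)

/-- `X` is a solution of `i_X Ω₀ = dH` at the point `w` of `W₀`. -/
def SolvesAt (A : LocalAlgebroid H F) (L : (H × F) × F → ℝ) (w : PontryaginSpace H F)
    (X : PontryaginFiber F) : Prop :=
  ∀ Y : PontryaginFiber F,
    A.presymplectic w X Y = A.pontryagin.dZero (pontryaginHamiltonian L) w Y

/-- `w` is, on `J`, an integral curve of the vector field `ρ^ν(X)` of a solution `X` of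
`i_X Ω₀ = dH` along `w`. -/
def IsSolutionCurve (A : LocalAlgebroid H F) (L : (H × F) × F → ℝ) (J : Set ℝ)
    (w : ℝ → PontryaginSpace H F) : Prop :=
  ∃ X : ℝ → PontryaginFiber F, ∀ t ∈ J,
    A.SolvesAt L (w t) (X t) ∧ HasDerivAt w (A.pontryagin.anchor (w t) (X t)) t

end General

/-! ### Coordinate expressions: `H = ℝᵐ`, `F = ℝ^ι` -/

section Coordinates

variable {m : ℕ} {ι : Type*} [Fintype ι] [DecidableEq ι]

/-- `ρ^i_A(x)`. -/
def rho (A : LocalAlgebroid (EuclideanSpace ℝ (Fin m)) (ι → ℝ)) (x : EuclideanSpace ℝ (Fin m))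
    (i : Fin m) (a : ι) : ℝ :=
  A.anchor x (Pi.single a 1) i

/-- `C^c_{ab}(x)`. -/
def structFn (A : LocalAlgebroid (EuclideanSpace ℝ (Fin m)) (ι → ℝ)) (x : EuclideanSpace ℝ (Fin m))
    (a b c : ι) : ℝ :=
  A.struct x (Pi.single a 1) (Pi.single b 1) c

/-- `∂L/∂x^i`. -/
def dLx (L : (EuclideanSpace ℝ (Fin m) × (ι → ℝ)) × (ι → ℝ) → ℝ)
    (q : (EuclideanSpace ℝ (Fin m) × (ι → ℝ)) × (ι → ℝ)) (i : Fin m) : ℝ :=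
  fderiv ℝ L q ((EuclideanSpace.single i 1, 0), 0)

/-- `∂L/∂y^a`. -/
def dLy (L : (EuclideanSpace ℝ (Fin m) × (ι → ℝ)) × (ι → ℝ) → ℝ)
    (q : (EuclideanSpace ℝ (Fin m) × (ι → ℝ)) × (ι → ℝ)) (a : ι) : ℝ :=
  fderiv ℝ L q ((0, Pi.single a 1), 0)

/-- `∂L/∂z^a`. -/
def dLz (L : (EuclideanSpace ℝ (Fin m) × (ι → ℝ)) × (ι → ℝ) → ℝ)
    (q : (EuclideanSpace ℝ (Fin m) × (ι → ℝ)) × (ι → ℝ)) (a : ι) : ℝ :=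
  fderiv ℝ L q (0, Pi.single a 1)

/-- The coordinate `p_a` of `((x, y), (z, α)) ∈ W₀`, where `α = p_a e^a_{(1)} + p̄_a e^a_{(2)}`. -/
def mom (w : PontryaginSpace (EuclideanSpace ℝ (Fin m)) (ι → ℝ)) (a : ι) : ℝ :=
  w.2.2 (Pi.single a 1, 0)

/-- The coordinate `p̄_a`. -/
def momBar (w : PontryaginSpace (EuclideanSpace ℝ (Fin m)) (ι → ℝ)) (a : ι) : ℝ :=
  w.2.2 (0, Pi.single a 1)

/-- The second-order equations with momenta, for a curve `w = (x, y, z, p, p̄)` in `W₀`: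
`ẋ^i = ρ^i_b y^b`, `ẏ^a = z^a`, `ṗ_a = ρ^i_a ∂L/∂x^i - C^c_{ab} p_c y^b`,
`dp̄_a/dt = -p_a + ∂L/∂y^a`, `p̄_a = ∂L/∂z^a`. -/
def MomentumEquations (A : LocalAlgebroid (EuclideanSpace ℝ (Fin m)) (ι → ℝ))
    (L : (EuclideanSpace ℝ (Fin m) × (ι → ℝ)) × (ι → ℝ) → ℝ) (J : Set ℝ)
    (w : ℝ → PontryaginSpace (EuclideanSpace ℝ (Fin m)) (ι → ℝ)) : Prop :=
  ∀ t ∈ J,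
    (∀ i, HasDerivAt (fun r => (w r).1.1 i) (∑ b, A.rho (w t).1.1 i b * (w t).1.2 b) t) ∧
    (∀ a, HasDerivAt (fun r => (w r).1.2 a) ((w t).2.1 a) t) ∧
    (∀ a, HasDerivAt (fun r => mom (w r) a)
      (∑ i, A.rho (w t).1.1 i a * dLx L ((w t).1, (w t).2.1) i
        - ∑ b, ∑ c, A.structFn (w t).1.1 a b c * mom (w t) c * (w t).1.2 b) t) ∧
    (∀ a, HasDerivAt (fun r => momBar (w r) a)
      (-mom (w t) a + dLy L ((w t).1, (w t).2.1) a) t) ∧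
    (∀ a, momBar (w t) a = dLz L ((w t).1, (w t).2.1) a)

/-- The second-order Euler–Lagrange equations on a Lie algebroid, for a curve `γ = ((x, y), z)` in
`E⁽²⁾`: `ẋ^i = ρ^i_b y^b`, `z^a = ẏ^a` and
`0 = d²/dt² (∂L/∂z^a) + C^c_{ab} y^b d/dt (∂L/∂z^c) - d/dt (∂L/∂y^a) - C^c_{ab} y^b ∂L/∂y^c
  + ρ^i_a ∂L/∂x^i`. -/
def SecondOrderEulerLagrange (A : LocalAlgebroid (EuclideanSpace ℝ (Fin m)) (ι → ℝ))
    (L : (EuclideanSpace ℝ (Fin m) × (ι → ℝ)) × (ι → ℝ) → ℝ) (J : Set ℝ)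
    (γ : ℝ → (EuclideanSpace ℝ (Fin m) × (ι → ℝ)) × (ι → ℝ)) : Prop :=
  ∀ t ∈ J,
    (∀ i, HasDerivAt (fun r => (γ r).1.1 i) (∑ b, A.rho (γ t).1.1 i b * (γ t).1.2 b) t) ∧
    (∀ a, HasDerivAt (fun r => (γ r).1.2 a) ((γ t).2 a) t) ∧
    (∀ a, 0 = deriv (deriv (fun r => dLz L (γ r) a)) t
        + ∑ b, ∑ c, A.structFn (γ t).1.1 a b c * (γ t).1.2 b * deriv (fun r => dLz L (γ r) c) t
        - deriv (fun r => dLy L (γ r) a) t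
        - ∑ b, ∑ c, A.structFn (γ t).1.1 a b c * (γ t).1.2 b * dLy L (γ t) c
        + ∑ i, A.rho (γ t).1.1 i a * dLx L (γ t) i)

/-- The classical second-order Euler–Lagrange equations, for a curve `γ = ((x, y), z)` with
`y = ẋ`, `z = ẏ`: `0 = d²/dt² (∂L/∂ẏ^i) - d/dt (∂L/∂y^i) + ∂L/∂x^i`. The fibre coordinates are
labelled through `h : Fin m → ι`. -/
def ClassicalEulerLagrange (h : Fin m → ι)
    (L : (EuclideanSpace ℝ (Fin m) × (ι → ℝ)) × (ι → ℝ) → ℝ) (J : Set ℝ)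
    (γ : ℝ → (EuclideanSpace ℝ (Fin m) × (ι → ℝ)) × (ι → ℝ)) : Prop :=
  ∀ t ∈ J,
    (∀ i, HasDerivAt (fun r => (γ r).1.1 i) ((γ t).1.2 (h i)) t) ∧
    (∀ i, HasDerivAt (fun r => (γ r).1.2 (h i)) ((γ t).2 (h i)) t) ∧
    (∀ i, 0 = deriv (deriv (fun r => dLz L (γ r) (h i))) t
        - deriv (fun r => dLy L (γ r) (h i)) t + dLx L (γ t) i)

/-- The second-order Euler–Poincaré equations with structure constants `c`, for a curve
`γ = ((x, ȳ), z)` with `z` the derivative of `ȳ`: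
`0 = d²/dt² (∂L/∂z^A) + c^C_{AB} ȳ^B d/dt (∂L/∂z^C) - d/dt (∂L/∂ȳ^A) - c^C_{AB} ȳ^B ∂L/∂ȳ^C`.
The fibre coordinates are labelled through `v : Fin d → ι`. -/
def EulerPoincare {d : ℕ} (v : Fin d → ι) (c : Fin d → Fin d → Fin d → ℝ)
    (L : (EuclideanSpace ℝ (Fin m) × (ι → ℝ)) × (ι → ℝ) → ℝ) (J : Set ℝ)
    (γ : ℝ → (EuclideanSpace ℝ (Fin m) × (ι → ℝ)) × (ι → ℝ)) : Prop :=
  ∀ t ∈ J,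
    (∀ B, HasDerivAt (fun r => (γ r).1.2 (v B)) ((γ t).2 (v B)) t) ∧
    (∀ A, 0 = deriv (deriv (fun r => dLz L (γ r) (v A))) t
        + ∑ B, ∑ C, c A B C * (γ t).1.2 (v B) * deriv (fun r => dLz L (γ r) (v C)) t
        - deriv (fun r => dLy L (γ r) (v A)) t
        - ∑ B, ∑ C, c A B C * (γ t).1.2 (v B) * dLy L (γ t) (v C))

/-- The second-order Lagrange–Poincaré equations, with fibre coordinates `y^i` (labelled through `h`)
and `ȳ^B` (labelled through `v`), structure constants `c A B C = c^C_{AB}`, local coefficients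
`𝒜 x i A = 𝒜^A_i(x)` of a principal connection and `ℬ x i j A = ℬ^A_{ij}(x)` of its curvature. -/
def LagrangePoincare {d : ℕ} (h : Fin m → ι) (v : Fin d → ι) (c : Fin d → Fin d → Fin d → ℝ)
    (𝒜 : EuclideanSpace ℝ (Fin m) → Fin m → Fin d → ℝ)
    (ℬ : EuclideanSpace ℝ (Fin m) → Fin m → Fin m → Fin d → ℝ)
    (L : (EuclideanSpace ℝ (Fin m) × (ι → ℝ)) × (ι → ℝ) → ℝ) (J : Set ℝ)
    (γ : ℝ → (EuclideanSpace ℝ (Fin m) × (ι → ℝ)) × (ι → ℝ)) : Prop :=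
  ∀ t ∈ J,
    (∀ i, HasDerivAt (fun r => (γ r).1.1 i) ((γ t).1.2 (h i)) t) ∧
    (∀ i, HasDerivAt (fun r => (γ r).1.2 (h i)) ((γ t).2 (h i)) t) ∧
    (∀ B, HasDerivAt (fun r => (γ r).1.2 (v B)) ((γ t).2 (v B)) t) ∧
    (∀ j, dLx L (γ t) j - deriv (fun r => dLy L (γ r) (h j)) t
          + deriv (deriv (fun r => dLz L (γ r) (h j))) t
        = -∑ A, (deriv (fun r => dLz L (γ r) (v A)) t - dLy L (γ t) (v A)) *
            (∑ i, ℬ (γ t).1.1 i j A * (γ t).1.2 (h i)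
              + ∑ D, ∑ B, c D B A * 𝒜 (γ t).1.1 j B * (γ t).1.2 (v D))) ∧
    (∀ B, deriv (deriv (fun r => dLz L (γ r) (v B))) t - deriv (fun r => dLy L (γ r) (v B)) t
        = ∑ A, (deriv (fun r => dLz L (γ r) (v A)) t - dLy L (γ t) (v A)) *
            (∑ D, c D B A * (γ t).1.2 (v D)
              - ∑ D, ∑ i, c D B A * 𝒜 (γ t).1.1 i D * (γ t).1.2 (h i)))

end Coordinates

end LocalAlgebroid

/-! ### A Lie algebroid in a chart of the base and a local frame -/

namespace LieAlgebroid

section Restrict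

variable {m : ℕ} {M : Type*} [TopologicalSpace M]
  [ChartedSpace (EuclideanSpace ℝ (Fin m)) M] [IsManifold (𝓡 m) ∞ M]
  {F : Type*} [NormedAddCommGroup F] [NormedSpace ℝ F]
  {V : M → Type*} [TopologicalSpace (TotalSpace F V)]
  [∀ x, AddCommGroup (V x)] [∀ x, Module ℝ (V x)] [∀ x, TopologicalSpace (V x)]
  [FiberBundle F V] [VectorBundle ℝ F V]

open Classical in
/-- A global smooth section that coincides near `x` with the (locally defined) section `σ`. -/
def germExtension (σ : ∀ y, V y) (x : M) : Cₛ^∞⟮𝓡 m; F, V⟯ :=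
  if h : ∃ S : Cₛ^∞⟮𝓡 m; F, V⟯, ∀ᶠ y in 𝓝 x, S y = σ y then h.choose else 0

variable {ι : Type*} [Fintype ι]

/-- The structure functions `C^c_{ab}` of a Lie algebroid in a local frame:
`⟦e_a, e_b⟧ = C^c_{ab} e_c`. -/
def structureFunction (E : LieAlgebroid m F V) {u : Set M} {s : ι → (x : M) → V x}
    (hs : IsLocalFrameOn (𝓡 m) F ∞ s u) (a b c : ι) (x : M) : ℝ :=
  hs.coeff c x (E.bracket (germExtension (s a) x) (germExtension (s b) x) x)

/-- The Lie algebroid `E` over the domain of the chart `φ` of `M`, trivialised by a local frame. -/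
def restrict (E : LieAlgebroid m F V) (φ : OpenPartialHomeomorph M (EuclideanSpace ℝ (Fin m)))
    {s : ι → (x : M) → V x} (hs : IsLocalFrameOn (𝓡 m) F ∞ s φ.source) :
    LocalAlgebroid (EuclideanSpace ℝ (Fin m)) (ι → ℝ) where
  dom := φ.target
  anchor x := ((mfderiv (𝓡 m) (𝓡 m) φ (φ.symm x)).toLinearMap.comp
    (E.anchor (φ.symm x)).toLinearMap).comp
      (Fintype.linearCombination ℝ (fun a => s a (φ.symm x)))
  struct x := LinearMap.mk₂ ℝ
    (fun y y' c => ∑ a, ∑ b, y a * y' b * E.structureFunction hs a b c (φ.symm x))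
    (by intro y y' y''; ext c; simp [add_mul, Finset.sum_add_distrib])
    (by intro r y y'; ext c; simp [mul_assoc, Finset.mul_sum])
    (by intro y y' y''; ext c; simp [add_mul, mul_add, Finset.sum_add_distrib])
    (by intro r y y'; ext c; simp [mul_assoc, mul_left_comm, Finset.mul_sum])

/-- The set `E⁽²⁾` of admissible elements: the vectors `v` tangent to `E` at a point `e` with
`Tτ_E(v) = ρ(e)`. -/
def Admissible (E : LieAlgebroid m F V) :
    Set (TangentBundle ((𝓡 m).prod 𝓘(ℝ, F)) (TotalSpace F V)) :=
  {v | mfderiv ((𝓡 m).prod 𝓘(ℝ, F)) (𝓡 m) (TotalSpace.proj : TotalSpace F V → M) v.proj v.snd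
    = E.anchor v.proj.proj v.proj.snd}

/-- The parametrisation `(x, y) ↦ y^a e_a(x)` of `E` by a chart of `M` and a frame. -/
def frameParam (φ : OpenPartialHomeomorph M (EuclideanSpace ℝ (Fin m)))
    (s : ι → (x : M) → V x) (q : EuclideanSpace ℝ (Fin m) × (ι → ℝ)) : TotalSpace F V :=
  ⟨φ.symm q.1, ∑ a, q.2 a • s a (φ.symm q.1)⟩

/-- The parametrisation of `E⁽²⁾` by the adapted coordinates `((x, y), z)`: the tangent vector to
`E` at the point with coordinates `(x, y)` whose components are `(ρ(x) y, z)`. -/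
def admParam (E : LieAlgebroid m F V) (φ : OpenPartialHomeomorph M (EuclideanSpace ℝ (Fin m)))
    {s : ι → (x : M) → V x} (hs : IsLocalFrameOn (𝓡 m) F ∞ s φ.source)
    (q : (EuclideanSpace ℝ (Fin m) × (ι → ℝ)) × (ι → ℝ)) :
    TangentBundle ((𝓡 m).prod 𝓘(ℝ, F)) (TotalSpace F V) :=
  ⟨frameParam φ s q.1,
    mfderiv 𝓘(ℝ, EuclideanSpace ℝ (Fin m) × (ι → ℝ)) ((𝓡 m).prod 𝓘(ℝ, F)) (frameParam φ s) q.1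
      ((E.restrict φ hs).anchor q.1.1 q.1.2, q.2)⟩

theorem mdifferentiableAt_frameParam
    {φ : OpenPartialHomeomorph M (EuclideanSpace ℝ (Fin m))}
    (hφ : φ ∈ IsManifold.maximalAtlas (𝓡 m) ∞ M)
    {s : ι → (x : M) → V x} (hs : IsLocalFrameOn (𝓡 m) F ∞ s φ.source)
    {q : EuclideanSpace ℝ (Fin m) × (ι → ℝ)} (hq : q.1 ∈ φ.target) :
    MDifferentiableAt 𝓘(ℝ, EuclideanSpace ℝ (Fin m) × (ι → ℝ)) ((𝓡 m).prod 𝓘(ℝ, F))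
      (frameParam (F := F) φ s) q := by
  have hsymm : ContMDiffAt 𝓘(ℝ, EuclideanSpace ℝ (Fin m) × (ι → ℝ)) (𝓡 m) ∞
      (fun p : EuclideanSpace ℝ (Fin m) × (ι → ℝ) => φ.symm p.1) q := by
    have h1 : ContMDiffAt (𝓡 m) (𝓡 m) ∞ φ.symm q.1 :=
      (contMDiffOn_symm_of_mem_maximalAtlas hφ).contMDiffAt (φ.open_target.mem_nhds hq)
    exact h1.comp q contDiff_fst.contMDiff.contMDiffAt
  have hx : φ.symm q.1 ∈ φ.source := φ.map_target hq
  set e := trivializationAt F V (φ.symm q.1) with he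
  have hsa : ∀ a, ContMDiffAt 𝓘(ℝ, EuclideanSpace ℝ (Fin m) × (ι → ℝ)) 𝓘(ℝ, F) ∞
      (fun p : EuclideanSpace ℝ (Fin m) × (ι → ℝ) => (e ⟨φ.symm p.1, s a (φ.symm p.1)⟩).2) q := by
    intro a
    have h1 := hs.contMDiffAt φ.open_source hx a
    rw [contMDiffAt_section] at h1
    exact ContMDiffAt.comp (I' := 𝓡 m) (g := fun x => (e ⟨x, s a x⟩).2)
      (f := fun p : EuclideanSpace ℝ (Fin m) × (ι → ℝ) => φ.symm p.1) q h1 hsymm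
  refine ContMDiffAt.mdifferentiableAt (n := ∞) ?_ (by simp)
  rw [contMDiffAt_totalSpace]
  refine ⟨hsymm, ?_⟩
  have hsum : ContMDiffAt 𝓘(ℝ, EuclideanSpace ℝ (Fin m) × (ι → ℝ)) 𝓘(ℝ, F) ∞
      (fun p : EuclideanSpace ℝ (Fin m) × (ι → ℝ) =>
        ∑ a, p.2 a • (e ⟨φ.symm p.1, s a (φ.symm p.1)⟩).2) q := by
    rw [contMDiffAt_iff_contDiffAt]
    refine ContDiffAt.sum fun a _ => ?_
    refine ContDiffAt.smul ?_ (contMDiffAt_iff_contDiffAt.mp (hsa a))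
    fun_prop
  refine hsum.congr_of_eventuallyEq ?_
  have hnhds : ∀ᶠ p in 𝓝 q, φ.symm p.1 ∈ e.baseSet :=
    hsymm.continuousAt.eventually (e.open_baseSet.mem_nhds (mem_baseSet_trivializationAt F V _))
  filter_upwards [hnhds] with p hp
  have : ∀ v, (e ⟨φ.symm p.1, v⟩).2 = e.linearMapAt ℝ (φ.symm p.1) v := by
    intro v; rw [Trivialization.coe_linearMapAt_of_mem _ hp]
  simp only [frameParam]
  change (e ⟨φ.symm p.1, _⟩).2 = _
  simp only [this, map_sum, map_smul]

theorem admParam_mem (E : LieAlgebroid m F V)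
    {φ : OpenPartialHomeomorph M (EuclideanSpace ℝ (Fin m))}
    (hφ : φ ∈ IsManifold.maximalAtlas (𝓡 m) ∞ M)
    {s : ι → (x : M) → V x} (hs : IsLocalFrameOn (𝓡 m) F ∞ s φ.source)
    {q : (EuclideanSpace ℝ (Fin m) × (ι → ℝ)) × (ι → ℝ)} (hq : q.1.1 ∈ φ.target) :
    E.admParam φ hs q ∈ E.Admissible := by
  have hx : φ.symm q.1.1 ∈ φ.source := φ.map_target hq
  have hφm : MDifferentiableAt (𝓡 m) (𝓡 m) φ (φ.symm q.1.1) :=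
    ((contMDiffOn_of_mem_maximalAtlas hφ).contMDiffAt
      (φ.open_source.mem_nhds hx)).mdifferentiableAt (by simp)
  have hsm : MDifferentiableAt (𝓡 m) (𝓡 m) φ.symm q.1.1 :=
    ((contMDiffOn_symm_of_mem_maximalAtlas hφ).contMDiffAt
      (φ.open_target.mem_nhds hq)).mdifferentiableAt (by simp)
  have hproj : MDifferentiableAt ((𝓡 m).prod 𝓘(ℝ, F)) (𝓡 m)
      (TotalSpace.proj : TotalSpace F V → M) (frameParam φ s q.1) :=
    ((contMDiff_proj (n := ∞) V).contMDiffAt).mdifferentiableAt (by simp)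
  have hpar := mdifferentiableAt_frameParam hφ hs hq
  -- `τ ∘ frameParam = φ⁻¹ ∘ fst`
  have hcomp := mfderiv_comp q.1 hproj hpar
  have hfst : MDifferentiableAt 𝓘(ℝ, EuclideanSpace ℝ (Fin m) × (ι → ℝ)) (𝓡 m)
      (Prod.fst : EuclideanSpace ℝ (Fin m) × (ι → ℝ) → EuclideanSpace ℝ (Fin m)) q.1 :=
    mdifferentiableAt_iff_differentiableAt.mpr differentiableAt_fst
  have hcomp' := mfderiv_comp q.1 hsm hfst
  have heq : ((TotalSpace.proj : TotalSpace F V → M) ∘ frameParam (F := F) φ s)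
      = φ.symm ∘ Prod.fst := rfl
  rw [heq, hcomp'] at hcomp
  have hv := DFunLike.congr_fun hcomp ((E.restrict φ hs).anchor q.1.1 q.1.2, q.2)
  have hfd : ∀ u : EuclideanSpace ℝ (Fin m) × (ι → ℝ),
      mfderiv 𝓘(ℝ, EuclideanSpace ℝ (Fin m) × (ι → ℝ)) (𝓡 m)
      (Prod.fst : EuclideanSpace ℝ (Fin m) × (ι → ℝ) → EuclideanSpace ℝ (Fin m)) q.1 u = u.1 := by
    intro u
    rw [mfderiv_eq_fderiv, fderiv_fst]
    rfl
  have hid : ∀ u, mfderiv (𝓡 m) (𝓡 m) φ.symm q.1.1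
      (mfderiv (𝓡 m) (𝓡 m) φ (φ.symm q.1.1) u) = u := by
    intro u
    have h1 : MDifferentiableAt (𝓡 m) (𝓡 m) φ.symm (φ (φ.symm q.1.1)) := by
      rw [φ.right_inv hq]; exact hsm
    have h2 := mfderiv_comp (φ.symm q.1.1) h1 hφm
    have h3 : mfderiv (𝓡 m) (𝓡 m) (φ.symm ∘ φ) (φ.symm q.1.1)
        = ContinuousLinearMap.id ℝ (TangentSpace (𝓡 m) (φ.symm q.1.1)) := by
      rw [Filter.EventuallyEq.mfderiv_eq (f := id) ?_]
      · exact mfderiv_id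
      · filter_upwards [φ.open_source.mem_nhds hx] with y hy
        exact φ.left_inv hy
    rw [h2, φ.right_inv hq] at h3
    exact DFunLike.congr_fun h3 u
  change mfderiv ((𝓡 m).prod 𝓘(ℝ, F)) (𝓡 m) (TotalSpace.proj : TotalSpace F V → M)
    (frameParam φ s q.1) _ = _
  refine hv.symm.trans ?_
  change mfderiv (𝓡 m) (𝓡 m) φ.symm q.1.1
    (mfderiv 𝓘(ℝ, EuclideanSpace ℝ (Fin m) × (ι → ℝ)) (𝓡 m)
      (Prod.fst : EuclideanSpace ℝ (Fin m) × (ι → ℝ) → EuclideanSpace ℝ (Fin m)) q.1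
        ((E.restrict φ hs).anchor q.1.1 q.1.2, q.2)) = _
  rw [hfd]
  refine (hid _).trans ?_
  rfl

open Classical in
/-- The coordinate expression `L(x, y, z)` of a function `L` on `E⁽²⁾`. -/
def lagrangianCoord (E : LieAlgebroid m F V)
    {φ : OpenPartialHomeomorph M (EuclideanSpace ℝ (Fin m))}
    (hφ : φ ∈ IsManifold.maximalAtlas (𝓡 m) ∞ M)
    {s : ι → (x : M) → V x} (hs : IsLocalFrameOn (𝓡 m) F ∞ s φ.source) (L : E.Admissible → ℝ)
    (q : (EuclideanSpace ℝ (Fin m) × (ι → ℝ)) × (ι → ℝ)) : ℝ :=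
  if h : q.1.1 ∈ φ.target then L ⟨E.admParam φ hs q, E.admParam_mem hφ hs h⟩ else 0

/-! ### The Atiyah case -/

/-- The fundamental vector field `ξ ↦ (T_e R_g)(ξ)` at `g` of the action of `G` on itself by left
translations. -/
def rightTranslate {d : ℕ} {G : Type*} [TopologicalSpace G] [ChartedSpace (EuclideanSpace ℝ (Fin d)) G]
    [Group G] (ξ : GroupLieAlgebra (𝓡 d) G) (g : G) : TangentSpace (𝓡 d) g :=
  (mfderiv (𝓡 d) (𝓡 d) (fun h : G => h * g) 1 ξ : EuclideanSpace ℝ (Fin d))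

/-- The adjoint representation, the derivative of `k ↦ g k g⁻¹` at the identity. -/
def adjointAction {d : ℕ} {G : Type*} [TopologicalSpace G] [ChartedSpace (EuclideanSpace ℝ (Fin d)) G]
    [Group G] (g : G) (ξ : GroupLieAlgebra (𝓡 d) G) : GroupLieAlgebra (𝓡 d) G :=
  (mfderiv (𝓡 d) (𝓡 d) (fun k : G => g * k * g⁻¹) 1 ξ : EuclideanSpace ℝ (Fin d))

/-- An identification of the Lie algebroid `E`, over the domain `U` of a chart `φ` of its base, with
the Atiyah algebroid `T(U × G)/G` of the principal bundle `U × G → U` (a local trivialisation of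
`Q → Q/G`), where `G` acts by left translations of the second factor. The class in `T(U × G)/G` of
a vector `(u, w)` tangent at `(x, 1)` is recorded as `(u, w) ∈ ℝᵐ × 𝔤`; the `G`-invariant vector
field with these values is `(x, g) ↦ (u, T_eL_g(w))`. -/
structure AtiyahTrivialization (E : LieAlgebroid m F V)
    (φ : OpenPartialHomeomorph M (EuclideanSpace ℝ (Fin m))) (d : ℕ) (G : Type*)
    [TopologicalSpace G] [ChartedSpace (EuclideanSpace ℝ (Fin d)) G] [Group G] where
  /-- the bundle map -/
  toFun : ∀ x : M, V x →ₗ[ℝ] EuclideanSpace ℝ (Fin m) × GroupLieAlgebra (𝓡 d) G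
  bijective : ∀ x ∈ φ.source, Function.Bijective (toFun x)
  smooth : ∀ σ : Cₛ^∞⟮𝓡 m; F, V⟯,
    ContDiffOn ℝ ∞ (fun x => (((toFun (φ.symm x) (σ (φ.symm x))).1,
      (toFun (φ.symm x) (σ (φ.symm x))).2) :
        EuclideanSpace ℝ (Fin m) × EuclideanSpace ℝ (Fin d))) φ.target
  /-- the anchor is the projection `[v] ↦ Tπ(v)` -/
  anchor_eq : ∀ x ∈ φ.source, ∀ v : V x,
    (toFun x v).1 = mfderiv (𝓡 m) (𝓡 m) φ x (E.anchor x v)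
  /-- the bracket of sections is the bracket of the corresponding `G`-invariant vector fields -/
  bracket_eq : ∀ (σ τ : Cₛ^∞⟮𝓡 m; F, V⟯), ∀ x ∈ φ.target, ∀ g : G,
    VectorField.mlieBracket ((𝓡 m).prod (𝓡 d))
      (fun p : EuclideanSpace ℝ (Fin m) × G => (((toFun (φ.symm p.1) (σ (φ.symm p.1))).1,
        mulInvariantVectorField (toFun (φ.symm p.1) (σ (φ.symm p.1))).2 p.2) :
          TangentSpace ((𝓡 m).prod (𝓡 d)) p))
      (fun p : EuclideanSpace ℝ (Fin m) × G => (((toFun (φ.symm p.1) (τ (φ.symm p.1))).1,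
        mulInvariantVectorField (toFun (φ.symm p.1) (τ (φ.symm p.1))).2 p.2) :
          TangentSpace ((𝓡 m).prod (𝓡 d)) p)) (x, g)
      = ((toFun (φ.symm x) (E.bracket σ τ (φ.symm x))).1,
        mulInvariantVectorField (toFun (φ.symm x) (E.bracket σ τ (φ.symm x))).2 g)

end Restrict

end LieAlgebroid

/-- A principal connection on the principal bundle `U × G → U` (`U` open in `ℝᵐ`), as an equivariant
`𝔤`-valued one-form reproducing the infinitesimal generators of the action of `G`. -/
structure PrincipalConnection {m : ℕ} (U : Set (EuclideanSpace ℝ (Fin m))) (d : ℕ) (G : Type*)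
    [TopologicalSpace G] [ChartedSpace (EuclideanSpace ℝ (Fin d)) G] [Group G] where
  /-- the value at `(x, g)` on the tangent vector `(u, w)` -/
  form : ∀ (_ : EuclideanSpace ℝ (Fin m)) (g : G),
    EuclideanSpace ℝ (Fin m) × TangentSpace (𝓡 d) g →ₗ[ℝ] GroupLieAlgebra (𝓡 d) G
  vertical : ∀ x ∈ U, ∀ (g : G) (ξ : GroupLieAlgebra (𝓡 d) G),
    form x g (0, LieAlgebroid.rightTranslate ξ g) = ξ
  equivariant : ∀ x ∈ U, ∀ (h g : G) (u : EuclideanSpace ℝ (Fin m)) (w : TangentSpace (𝓡 d) g),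
    form x (h * g) (u, mfderiv (𝓡 d) (𝓡 d) (fun k : G => h * k) g w)
      = LieAlgebroid.adjointAction h (form x g (u, w))
  smooth : ∀ u : EuclideanSpace ℝ (Fin m),
    ContDiffOn (F := EuclideanSpace ℝ (Fin d)) ℝ ∞ (fun x => form x 1 (u, 0)) U

namespace PrincipalConnection

variable {m d : ℕ} {U : Set (EuclideanSpace ℝ (Fin m))} {G : Type*} [TopologicalSpace G]
  [ChartedSpace (EuclideanSpace ℝ (Fin d)) G] [Group G]

/-- `𝒜(∂/∂x^i)` at `(x, e)`. -/
def value (𝒜 : PrincipalConnection U d G) (x : EuclideanSpace ℝ (Fin m)) (i : Fin m) :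
    GroupLieAlgebra (𝓡 d) G :=
  𝒜.form x 1 (EuclideanSpace.single i 1, 0)

/-- `𝒜^A_i(x)`, with `𝒜(∂/∂x^i)|_{(x, e)} = 𝒜^A_i(x) ξ_A`. -/
def coeff (𝒜 : PrincipalConnection U d G) (ξ : Module.Basis (Fin d) ℝ (GroupLieAlgebra (𝓡 d) G))
    (x : EuclideanSpace ℝ (Fin m)) (i : Fin m) (A : Fin d) : ℝ :=
  ξ.repr (𝒜.value x i) A

end PrincipalConnection

/-- The structure constants `c^C_{AB}` of `𝔤`: `[ξ_A, ξ_B] = c^C_{AB} ξ_C`. -/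
def structureConstant {d : ℕ} {G : Type*} [TopologicalSpace G]
    [ChartedSpace (EuclideanSpace ℝ (Fin d)) G] [Group G]
    (ξ : Module.Basis (Fin d) ℝ (GroupLieAlgebra (𝓡 d) G)) (A B C : Fin d) : ℝ :=
  ξ.repr ⁅ξ A, ξ B⁆ C

/-- The coefficients `ℬ^A_{ij}` of the curvature, `ℬ(∂/∂x^i, ∂/∂x^j)|_{(x, e)} = ℬ^A_{ij}(x) ξ_A`, by
the structure equation `ℬ = d𝒜 - [𝒜, 𝒜]` of a left principal bundle:
`ℬ^A_{ij} = ∂𝒜^A_j/∂x^i - ∂𝒜^A_i/∂x^j - c^A_{BC} 𝒜^B_i 𝒜^C_j`. -/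
def PrincipalConnection.curvature {m d : ℕ} {U : Set (EuclideanSpace ℝ (Fin m))} {G : Type*}
    [TopologicalSpace G] [ChartedSpace (EuclideanSpace ℝ (Fin d)) G] [Group G]
    (𝒜 : PrincipalConnection U d G) (ξ : Module.Basis (Fin d) ℝ (GroupLieAlgebra (𝓡 d) G))
    (x : EuclideanSpace ℝ (Fin m)) (i j : Fin m) (A : Fin d) : ℝ :=
  fderiv ℝ (fun x' => 𝒜.coeff ξ x' j A) x (EuclideanSpace.single i 1)
    - fderiv ℝ (fun x' => 𝒜.coeff ξ x' i A) x (EuclideanSpace.single j 1)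
    - ∑ B, ∑ C, structureConstant ξ B C A * 𝒜.coeff ξ x i B * 𝒜.coeff ξ x j C

end

set_option linter.unusedSectionVars false

noncomputable section

namespace LocalAlgebroid

/-! ### The equation `i_X Ω₀ = dH` without fibre coordinates -/

section General

variable {H F : Type*} [NormedAddCommGroup H] [NormedSpace ℝ H]
  [NormedAddCommGroup F] [NormedSpace ℝ F]

/-! In adapted coordinates the constant sections form a frame of a prolongation. Their brackets are
those of the underlying algebroid, with zero vertical part, so every intrinsic object becomes an
explicit formula. Differentiating the Liouville section gives `Ω(ξ, η) = η₂(ξ₁) - ξ₂(η₁) + q₂(C(ξ₁,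
η₁))` (`canonicalSymplectic_eq`). Its pull-back `Ω₀` does not see the `z`-direction. The function
`H` is a pairing minus `L`, so `dH` is explicit as well (`dZero_pontryaginHamiltonian`).

Both sides of `i_X Ω₀ = dH` are linear in the test vector `Y`, and the equation splits along the
components of `Y` (`solvesAt_iff`). The covector component forces the `E`-part of `X` to be `(y,
z)`. The two `E`-components give the `p`- and `p̄`-components of `X`. The `z`-component, which lies
in the kernel of `Ω₀`, leaves the constraint `p̄ = ∂L/∂z`. The `z`-component of `X` occurs nowhere
and is arbitrary. Along a curve the anchor turns these components into velocities
(`isSolutionCurve_iff`).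

On an open set of times the constraint may be differentiated. Comparison with the `p̄`-equation
gives `p = ∂L/∂y - d/dt ∂L/∂z`; a second differentiation, compared with the `p`-equation, gives the
second-order Euler–Lagrange equations. Every step reverses (`momentumEquations_iff`).

The Atiyah case needs only the structure functions, and these come from one bracket: for invariant
fields on `U × G` with constant horizontal parts, `[(u, ζ), (u', ζ')] = (0, ∂_u ζ' - ∂_{u'} ζ + [ζ,
ζ'])` at the identity of `G` (`mlieBracket_invariantField`). Taking `ζ` among `-𝒜_i` and `ξ_B`
yields `C^A_{ij} = -ℬ^A_{ij}`, `C^A_{iB} = -𝒜^D_i c^A_{DB}`, `C^A_{BD} = c^A_{BD}`, while all `C^i`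
vanish. The Lagrange–Poincaré equations follow by substitution, because the two structure terms
share the factor `d/dt ∂L/∂z - ∂L/∂y`. The last two equivalences arise when the sums over an empty
index set disappear. -/

theorem dZero_liouville (A : LocalAlgebroid (H × (F →L[ℝ] ℝ)) (F × (F →L[ℝ] ℝ)))
    (q : H × (F →L[ℝ] ℝ)) (ξ η : F × (F →L[ℝ] ℝ)) :
    A.dZero (fun q' => liouville q' η) q ξ = (A.anchor q ξ).2 η.1 := by
  let ℓ : H × (F →L[ℝ] ℝ) →L[ℝ] ℝ :=
    (ContinuousLinearMap.apply ℝ ℝ η.1).comp (ContinuousLinearMap.snd ℝ H (F →L[ℝ] ℝ))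
  change fderiv ℝ ℓ q _ = _
  rw [ℓ.fderiv]
  rfl

theorem canonicalSymplectic_eq (A : LocalAlgebroid H F) (q : H × (F →L[ℝ] ℝ))
    (ξ η : F × (F →L[ℝ] ℝ)) :
    A.canonicalSymplectic q ξ η = η.2 ξ.1 - ξ.2 η.1 + q.2 (A.struct q.1 ξ.1 η.1) := by
  simp only [canonicalSymplectic, dOne, dZero_liouville, bracket, fderiv_fun_const]
  simp [prolong, liouville]
  ring

/-- The bracket of constant sections of `𝒯E` has no second component, so only the momenta `p`, not
`p̄`, meet the structure functions. The components `X.2.1` and `Y.2.1` are absent: this is the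
degeneracy of `Ω₀`. -/
theorem presymplectic_eq (A : LocalAlgebroid H F) (w : PontryaginSpace H F)
    (X Y : PontryaginFiber F) :
    A.presymplectic w X Y
      = Y.2.2 X.1 - X.2.2 Y.1 + w.2.2 (A.struct w.1.1 X.1.1 Y.1.1, 0) := by
  rw [presymplectic, canonicalSymplectic_eq]
  rfl

theorem dZero_pontryaginHamiltonian (A : LocalAlgebroid H F) {L : (H × F) × F → ℝ}
    {w : PontryaginSpace H F} (hL : DifferentiableAt ℝ L (w.1, w.2.1)) (Y : PontryaginFiber F) :
    A.pontryagin.dZero (pontryaginHamiltonian L) w Y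
      = Y.2.2 (w.1.2, w.2.1) + w.2.2 (Y.1.2, Y.2.1)
        - fderiv ℝ L (w.1, w.2.1) ((A.anchor w.1.1 Y.1.1, Y.1.2), Y.2.1) := by
  let p : PontryaginSpace H F →L[ℝ] (F × F) →L[ℝ] ℝ :=
    (ContinuousLinearMap.snd ℝ F _).comp (ContinuousLinearMap.snd ℝ (H × F) _)
  have h1 : HasFDerivAt (fun w : PontryaginSpace H F => w.2.2) p w := p.hasFDerivAt
  let ℓ : PontryaginSpace H F →L[ℝ] F × F :=
    ((ContinuousLinearMap.snd ℝ H F).comp (ContinuousLinearMap.fst ℝ (H × F) _)).prod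
      ((ContinuousLinearMap.fst ℝ F _).comp (ContinuousLinearMap.snd ℝ (H × F) _))
  have h2 : HasFDerivAt (fun w : PontryaginSpace H F => (w.1.2, w.2.1)) ℓ w := ℓ.hasFDerivAt
  let k : PontryaginSpace H F →L[ℝ] (H × F) × F :=
    (ContinuousLinearMap.fst ℝ (H × F) _).prod
      ((ContinuousLinearMap.fst ℝ F _).comp (ContinuousLinearMap.snd ℝ (H × F) _))
  have h3 : HasFDerivAt (fun w : PontryaginSpace H F => L (w.1, w.2.1))
      ((fderiv ℝ L (w.1, w.2.1)).comp k) w :=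
    HasFDerivAt.comp (g := L) (f := fun w : PontryaginSpace H F => (w.1, w.2.1)) w
      hL.hasFDerivAt k.hasFDerivAt
  have h4 : HasFDerivAt (pontryaginHamiltonian L) _ w := (h1.clm_apply h2).sub h3
  rw [dZero, h4.fderiv]
  simp [pontryagin, tangent, prolong, p, ℓ, k]
  ring

/-- The equation `i_X Ω₀ = dH`, without coordinates in the fibres. -/
theorem solvesAt_iff (A : LocalAlgebroid H F) {L : (H × F) × F → ℝ} {w : PontryaginSpace H F}
    (hL : DifferentiableAt ℝ L (w.1, w.2.1)) (X : PontryaginFiber F) :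
    A.SolvesAt L w X ↔
      X.1 = (w.1.2, w.2.1) ∧
      (∀ b, X.2.2 (b, 0) = w.2.2 (A.struct w.1.1 X.1.1 b, 0)
        + fderiv ℝ L (w.1, w.2.1) ((A.anchor w.1.1 b, 0), 0)) ∧
      (∀ b, X.2.2 (0, b) = -w.2.2 (b, 0) + fderiv ℝ L (w.1, w.2.1) ((0, b), 0)) ∧
      (∀ b, w.2.2 (0, b) = fderiv ℝ L (w.1, w.2.1) (0, b)) := by
  simp only [SolvesAt, presymplectic_eq, dZero_pontryaginHamiltonian A hL]
  constructor
  · intro h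
    refine ⟨?_, fun b => ?_, fun b => ?_, fun b => ?_⟩
    -- Each test vector has one nonzero component. Here it is a functional `v`, and the equation
    -- says that `v` takes the same value at `X.1` and `(y, z)`; continuous functionals separate
    -- points.
    · refine (SeparatingDual.eq_iff_forall_dual_eq (R := ℝ)).mpr fun v => ?_
      have := h (0, (0, v))
      simpa [← Prod.zero_eq_mk] using this
    · have := h ((b, 0), (0, 0))
      simp [← Prod.zero_eq_mk] at this
      linarith
    · have := h ((0, b), (0, 0))
      simp [← Prod.zero_eq_mk] at this
      linarith
    -- This direction lies in the kernel of `Ω₀`, so what remains is a condition on the point `w`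
    -- alone.
    · have := h ((0, 0), (b, 0))
      simp [← Prod.zero_eq_mk] at this
      linarith
  · rintro ⟨h1, h2, h3, h4⟩ Y
    have e1 : X.2.2 Y.1 = X.2.2 (Y.1.1, 0) + X.2.2 (0, Y.1.2) := by
      rw [← map_add]; simp
    have e2 : w.2.2 (Y.1.2, Y.2.1) = w.2.2 (Y.1.2, 0) + w.2.2 (0, Y.2.1) := by
      rw [← map_add]; simp
    have e3 : fderiv ℝ L (w.1, w.2.1) ((A.anchor w.1.1 Y.1.1, Y.1.2), Y.2.1)
        = fderiv ℝ L (w.1, w.2.1) ((A.anchor w.1.1 Y.1.1, 0), 0)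
          + fderiv ℝ L (w.1, w.2.1) ((0, Y.1.2), 0) + fderiv ℝ L (w.1, w.2.1) (0, Y.2.1) := by
      rw [← map_add, ← map_add]; simp
    rw [e1, e2, e3, h2, h3, h4, h1]
    ring

end General

/-! ### Coordinate form of the solutions -/

section Coordinates

variable {m : ℕ} {ι : Type*} [Fintype ι] [DecidableEq ι]

theorem linearMap_apply_eq_sum_single {N : Type*} [AddCommGroup N] [Module ℝ N]
    (f : (ι → ℝ) →ₗ[ℝ] N) (b : ι → ℝ) : f b = ∑ a, b a • f (Pi.single a 1) := by
  rw [f.pi_apply_eq_sum_univ]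
  refine Finset.sum_congr rfl fun a _ => ?_
  congr 2
  ext j
  simp [Pi.single_apply, eq_comm]

theorem map_inl_eq_sum {K : Type*} [NormedAddCommGroup K] [NormedSpace ℝ K]
    (u : ((ι → ℝ) × K) →L[ℝ] ℝ) (b : ι → ℝ) :
    u (b, 0) = ∑ a, b a * u (Pi.single a 1, 0) := by
  simpa using linearMap_apply_eq_sum_single
    (u.comp (ContinuousLinearMap.inl ℝ (ι → ℝ) K)).toLinearMap b

theorem linearMap_ext_single {N : Type*} [AddCommGroup N] [Module ℝ N] {f g : (ι → ℝ) →ₗ[ℝ] N} :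
    (∀ b, f b = g b) ↔ ∀ a, f (Pi.single a 1) = g (Pi.single a 1) := by
  refine ⟨fun h a => h _, fun h b => ?_⟩
  rw [linearMap_apply_eq_sum_single f, linearMap_apply_eq_sum_single g]
  simp only [h]

/-- The structure functions are skew-symmetric. -/
def IsSkewAt (A : LocalAlgebroid (EuclideanSpace ℝ (Fin m)) (ι → ℝ))
    (x : EuclideanSpace ℝ (Fin m)) : Prop :=
  ∀ a b c, A.structFn x a b c = -A.structFn x b a c

theorem anchor_apply_eq_sum (A : LocalAlgebroid (EuclideanSpace ℝ (Fin m)) (ι → ℝ))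
    (x : EuclideanSpace ℝ (Fin m)) (y : ι → ℝ) (i : Fin m) :
    A.anchor x y i = ∑ b, A.rho x i b * y b := by
  rw [linearMap_apply_eq_sum_single (A.anchor x)]
  simp [rho, mul_comm]

/-- In `i_X Ω₀` the velocity `y` occupies the first slot of the bracket, whereas the coordinate
equations carry the free index first in `C^c_{ab}`. Skew-symmetry exchanges the two and produces the
minus sign in the equation for `p`. -/
theorem struct_single_apply (A : LocalAlgebroid (EuclideanSpace ℝ (Fin m)) (ι → ℝ))
    {x : EuclideanSpace ℝ (Fin m)} (hA : A.IsSkewAt x) (y : ι → ℝ) (a c : ι) :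
    A.struct x y (Pi.single a 1) c = -∑ b, A.structFn x a b c * y b := by
  have h := congrFun (linearMap_apply_eq_sum_single ((A.struct x).flip (Pi.single a 1)) y) c
  simp only [LinearMap.flip_apply] at h
  rw [h, ← Finset.sum_neg_distrib]
  simp only [Finset.sum_apply, Pi.smul_apply, smul_eq_mul]
  refine Finset.sum_congr rfl fun b _ => ?_
  rw [hA a b c]
  simp [structFn]
  ring

theorem fderiv_anchor_single (A : LocalAlgebroid (EuclideanSpace ℝ (Fin m)) (ι → ℝ))
    (L : (EuclideanSpace ℝ (Fin m) × (ι → ℝ)) × (ι → ℝ) → ℝ)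
    (q : (EuclideanSpace ℝ (Fin m) × (ι → ℝ)) × (ι → ℝ)) (x : EuclideanSpace ℝ (Fin m)) (a : ι) :
    fderiv ℝ L q ((A.anchor x (Pi.single a 1), 0), 0) = ∑ i, A.rho x i a * dLx L q i := by
  let ℓ : EuclideanSpace ℝ (Fin m) →L[ℝ] ℝ := (fderiv ℝ L q).comp
    ((ContinuousLinearMap.inl ℝ _ _).comp (ContinuousLinearMap.inl ℝ _ _))
  change ℓ (A.anchor x (Pi.single a 1)) = ∑ i, A.rho x i a * ℓ (EuclideanSpace.single i 1)
  conv_lhs => rw [← (EuclideanSpace.basisFun (Fin m) ℝ).sum_repr (A.anchor x (Pi.single a 1))]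
  simp [rho]

/-- The solutions of `i_X Ω₀ = dH` in adapted coordinates. -/
theorem solvesAt_iff_coordinates (A : LocalAlgebroid (EuclideanSpace ℝ (Fin m)) (ι → ℝ))
    {L : (EuclideanSpace ℝ (Fin m) × (ι → ℝ)) × (ι → ℝ) → ℝ}
    {w : PontryaginSpace (EuclideanSpace ℝ (Fin m)) (ι → ℝ)} (hA : A.IsSkewAt w.1.1)
    (hL : DifferentiableAt ℝ L (w.1, w.2.1)) (X : PontryaginFiber (ι → ℝ)) :
    A.SolvesAt L w X ↔
      (∀ a, X.1.1 a = w.1.2 a) ∧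
      (∀ a, X.1.2 a = w.2.1 a) ∧
      (∀ a, X.2.2 (Pi.single a 1, 0) =
        ∑ i, A.rho w.1.1 i a * dLx L (w.1, w.2.1) i
          - ∑ b, ∑ c, A.structFn w.1.1 a b c * mom w c * w.1.2 b) ∧
      (∀ a, X.2.2 (0, Pi.single a 1) = -mom w a + dLy L (w.1, w.2.1) a) ∧
      (∀ a, momBar w a = dLz L (w.1, w.2.1) a) := by
  have hstruct : ∀ a, w.2.2 (A.struct w.1.1 w.1.2 (Pi.single a 1), 0)
      = -∑ b, ∑ c, A.structFn w.1.1 a b c * mom w c * w.1.2 b := by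
    intro a
    rw [map_inl_eq_sum, Finset.sum_comm, ← Finset.sum_neg_distrib]
    refine Finset.sum_congr rfl fun c _ => ?_
    rw [A.struct_single_apply hA, neg_mul, Finset.sum_mul]
    congr 1
    refine Finset.sum_congr rfl fun b _ => ?_
    simp only [mom]
    ring
  rw [solvesAt_iff A hL, Prod.ext_iff, funext_iff, funext_iff, and_assoc]
  -- The structure term contains `X.1.1`, so the equation `X.1.1 = y` has to be available before the
  -- remaining equations can be compared.
  refine and_congr_right fun h1 => and_congr_right fun h2 => ?_
  rw [show X.1.1 = w.1.2 from funext h1]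
  refine and_congr ?_ (and_congr ?_ ?_)
  · refine (linearMap_ext_single (f := (X.2.2.comp (ContinuousLinearMap.inl ℝ _ _)).toLinearMap)
      (g := ((w.2.2.comp (ContinuousLinearMap.inl ℝ _ _)).toLinearMap.comp (A.struct w.1.1 w.1.2)) +
        ((fderiv ℝ L (w.1, w.2.1)).comp ((ContinuousLinearMap.inl ℝ _ _).comp
          (ContinuousLinearMap.inl ℝ _ _))).toLinearMap.comp (A.anchor w.1.1))).trans ?_
    refine forall_congr' fun a => ?_
    change X.2.2 (Pi.single a 1, 0) = w.2.2 (A.struct w.1.1 w.1.2 (Pi.single a 1), 0)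
      + fderiv ℝ L (w.1, w.2.1) ((A.anchor w.1.1 (Pi.single a 1), 0), 0) ↔ _
    rw [hstruct, fderiv_anchor_single, neg_add_eq_sub]
  · exact linearMap_ext_single (f := (X.2.2.comp (ContinuousLinearMap.inr ℝ _ _)).toLinearMap)
      (g := -(w.2.2.comp (ContinuousLinearMap.inl ℝ _ _)).toLinearMap +
        ((fderiv ℝ L (w.1, w.2.1)).comp ((ContinuousLinearMap.inl ℝ _ _).comp
          (ContinuousLinearMap.inr ℝ _ _))).toLinearMap)
  · exact linearMap_ext_single (f := (w.2.2.comp (ContinuousLinearMap.inr ℝ _ _)).toLinearMap)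
      (g := ((fderiv ℝ L (w.1, w.2.1)).comp (ContinuousLinearMap.inr ℝ _ _)).toLinearMap)

/-! ### Solution curves in `W₀` -/

theorem hasDerivAt_prod_iff {K K' : Type*} [NormedAddCommGroup K] [NormedSpace ℝ K]
    [NormedAddCommGroup K'] [NormedSpace ℝ K'] {f : ℝ → K × K'} {f' : K × K'} {t : ℝ} :
    HasDerivAt f f' t ↔
      HasDerivAt (fun r => (f r).1) f'.1 t ∧ HasDerivAt (fun r => (f r).2) f'.2 t :=
  ⟨fun h => ⟨h.fst, h.snd⟩, fun h => h.1.prodMk h.2⟩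

theorem hasDerivAt_euclidean_iff {f : ℝ → EuclideanSpace ℝ (Fin m)} {f' : EuclideanSpace ℝ (Fin m)}
    {t : ℝ} : HasDerivAt f f' t ↔ ∀ i, HasDerivAt (fun r => f r i) (f' i) t := by
  rw [← hasDerivAt_pi (φ := fun r i => f r i)]
  exact ⟨fun h => (EuclideanSpace.equiv (Fin m) ℝ).hasFDerivAt.comp_hasDerivAt t h,
    fun h => (EuclideanSpace.equiv (Fin m) ℝ).symm.hasFDerivAt.comp_hasDerivAt t h⟩

/-- Since a derivative is assumed to exist, only its value is in question; uniqueness of derivatives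
fixes that value on the basis vectors. -/
theorem hasDerivAt_covector_iff {α : ℝ → ((ι → ℝ) × (ι → ℝ)) →L[ℝ] ℝ}
    {α' : ((ι → ℝ) × (ι → ℝ)) →L[ℝ] ℝ} {t : ℝ} (hα : DifferentiableAt ℝ α t) :
    HasDerivAt α α' t ↔
      (∀ a, HasDerivAt (fun r => α r (Pi.single a 1, 0)) (α' (Pi.single a 1, 0)) t) ∧
      (∀ a, HasDerivAt (fun r => α r (0, Pi.single a 1)) (α' (0, Pi.single a 1)) t) := by
  have key : ∀ {β : ((ι → ℝ) × (ι → ℝ)) →L[ℝ] ℝ}, HasDerivAt α β t →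
      ∀ v, HasDerivAt (fun r => α r v) (β v) t := by
    intro β h v
    simpa using h.clm_apply (hasDerivAt_const t v)
  refine ⟨fun h => ⟨fun a => key h _, fun a => key h _⟩, fun ⟨h1, h2⟩ => ?_⟩
  have h3 : deriv α t = α' := by
    ext b
    · have h := linearMap_ext_single
        (f := ((deriv α t).comp (ContinuousLinearMap.inl ℝ _ _)).toLinearMap)
        (g := (α'.comp (ContinuousLinearMap.inl ℝ _ _)).toLinearMap)
      exact h.mpr (fun a => (key hα.hasDerivAt _).unique (h1 a)) b
    · have h := linearMap_ext_single
        (f := ((deriv α t).comp (ContinuousLinearMap.inr ℝ _ _)).toLinearMap)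
        (g := (α'.comp (ContinuousLinearMap.inr ℝ _ _)).toLinearMap)
      exact h.mpr (fun a => (key hα.hasDerivAt _).unique (h2 a)) b
  exact h3 ▸ hα.hasDerivAt

theorem hasDerivAt_pontryagin_anchor_iff
    (A : LocalAlgebroid (EuclideanSpace ℝ (Fin m)) (ι → ℝ))
    {w : ℝ → PontryaginSpace (EuclideanSpace ℝ (Fin m)) (ι → ℝ)} {t : ℝ}
    {X : PontryaginFiber (ι → ℝ)} (hw : DifferentiableAt ℝ w t) :
    HasDerivAt w (A.pontryagin.anchor (w t) X) t ↔
      (∀ i, HasDerivAt (fun r => (w r).1.1 i) (∑ b, A.rho (w t).1.1 i b * X.1.1 b) t) ∧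
      (∀ a, HasDerivAt (fun r => (w r).1.2 a) (X.1.2 a) t) ∧
      HasDerivAt (fun r => (w r).2.1) X.2.1 t ∧
      (∀ a, HasDerivAt (fun r => mom (w r) a) (X.2.2 (Pi.single a 1, 0)) t) ∧
      (∀ a, HasDerivAt (fun r => momBar (w r) a) (X.2.2 (0, Pi.single a 1)) t) := by
  rw [hasDerivAt_prod_iff, hasDerivAt_prod_iff (f := fun r => (w r).1),
    hasDerivAt_prod_iff (f := fun r => (w r).2), hasDerivAt_euclidean_iff,
    hasDerivAt_pi, hasDerivAt_covector_iff hw.snd.snd, and_assoc]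
  refine and_congr (forall_congr' fun i => ?_) Iff.rfl
  rw [← anchor_apply_eq_sum]
  rfl

/-- A curve in `W₀` whose points lie over the domain is a solution curve exactly if it satisfies the
equations with momenta. -/
theorem isSolutionCurve_iff (A : LocalAlgebroid (EuclideanSpace ℝ (Fin m)) (ι → ℝ))
    {L : (EuclideanSpace ℝ (Fin m) × (ι → ℝ)) × (ι → ℝ) → ℝ} {J : Set ℝ}
    {w : ℝ → PontryaginSpace (EuclideanSpace ℝ (Fin m)) (ι → ℝ)}
    (hA : ∀ t ∈ J, A.IsSkewAt (w t).1.1)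
    (hL : ∀ t ∈ J, DifferentiableAt ℝ L ((w t).1, (w t).2.1))
    (hw : ∀ t ∈ J, DifferentiableAt ℝ w t) :
    A.IsSolutionCurve L J w ↔ A.MomentumEquations L J w := by
  constructor
  · rintro ⟨X, hX⟩ t ht
    obtain ⟨h, hd⟩ := hX t ht
    obtain ⟨h1, h2, h3, h4, h5⟩ := (A.solvesAt_iff_coordinates (hA t ht) (hL t ht) _).mp h
    have := (A.hasDerivAt_pontryagin_anchor_iff (hw t ht)).mp hd
    simp only [h1, h2, h3, h4] at this
    exact ⟨this.1, this.2.1, this.2.2.2.1, this.2.2.2.2, h5⟩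
  · intro h
    -- The `E`-part of a solution is forced to be `(y, z)`; the rest of `X` is read off from the
    -- velocity of the curve. The free `z`-component is thereby chosen as `ż`.
    refine ⟨fun t => (((w t).1.2, (w t).2.1), (deriv w t).2), fun t ht => ?_⟩
    obtain ⟨h1, h2, h3, h4, h5⟩ := h t ht
    have hd := (hw t ht).hasDerivAt
    have hz : HasDerivAt (fun r => (w r).2.1) (deriv w t).2.1 t := hd.snd.fst
    have hα : HasDerivAt (fun r => (w r).2.2) (deriv w t).2.2 t := hd.snd.snd
    obtain ⟨h6, h7⟩ := (hasDerivAt_covector_iff hα.differentiableAt).mp hα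
    have e3 := fun a => (h6 a).unique (h3 a)
    have e4 := fun a => (h7 a).unique (h4 a)
    refine ⟨(A.solvesAt_iff_coordinates (hA t ht) (hL t ht) _).mpr
      ⟨fun _ => rfl, fun _ => rfl, e3, e4, h5⟩, ?_⟩
    exact (A.hasDerivAt_pontryagin_anchor_iff (hw t ht)).mpr ⟨h1, h2, hz, h6, h7⟩

/-! ### Elimination of the momenta -/

theorem contDiffOn_fderiv_comp_apply {K : Type*} [NormedAddCommGroup K] [NormedSpace ℝ K]
    {L : K → ℝ} {Ω : Set K} (hΩ : IsOpen Ω) (hL : ContDiffOn ℝ ∞ L Ω) {J : Set ℝ} {γ : ℝ → K}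
    (hγ : ContDiffOn ℝ ∞ γ J) (hmem : ∀ t ∈ J, γ t ∈ Ω) (v : K) :
    ContDiffOn ℝ ∞ (fun r => fderiv ℝ L (γ r) v) J :=
  ((hL.fderiv_of_isOpen hΩ (by simp)).comp hγ hmem).clm_apply contDiffOn_const

theorem differentiableAt_of_contDiffOn {K : Type*} [NormedAddCommGroup K] [NormedSpace ℝ K]
    {J : Set ℝ} (hJ : IsOpen J) {f : ℝ → K} (hf : ContDiffOn ℝ ∞ f J) {t : ℝ} (ht : t ∈ J) :
    DifferentiableAt ℝ f t :=
  (hf.contDiffAt (hJ.mem_nhds ht)).differentiableAt (by simp)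

theorem eliminate_momenta_sum (C : ι → ι → ℝ) (y u v : ι → ℝ) :
    ∑ b, ∑ c, C b c * (u c - v c) * y b
      = ∑ b, ∑ c, C b c * y b * u c - ∑ b, ∑ c, C b c * y b * v c := by
  simp only [← Finset.sum_sub_distrib]
  refine Finset.sum_congr rfl fun b _ => Finset.sum_congr rfl fun c _ => ?_
  ring

/-- Elimination of the momenta. -/
theorem momentumEquations_iff (A : LocalAlgebroid (EuclideanSpace ℝ (Fin m)) (ι → ℝ))
    {L : (EuclideanSpace ℝ (Fin m) × (ι → ℝ)) × (ι → ℝ) → ℝ}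
    {Ω : Set ((EuclideanSpace ℝ (Fin m) × (ι → ℝ)) × (ι → ℝ))} (hΩ : IsOpen Ω)
    (hL : ContDiffOn ℝ ∞ L Ω) {J : Set ℝ} (hJ : IsOpen J)
    {γ : ℝ → (EuclideanSpace ℝ (Fin m) × (ι → ℝ)) × (ι → ℝ)}
    (hγ : ContDiffOn ℝ ∞ γ J) (hmem : ∀ t ∈ J, γ t ∈ Ω)
    (α : ℝ → ((ι → ℝ) × (ι → ℝ)) →L[ℝ] ℝ) :
    A.MomentumEquations L J (fun t => ((γ t).1, ((γ t).2, α t))) ↔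
      A.SecondOrderEulerLagrange L J γ ∧
        ∀ t ∈ J, ∀ a,
          α t (0, Pi.single a 1) = dLz L (γ t) a ∧
          α t (Pi.single a 1, 0) = dLy L (γ t) a - deriv (fun r => dLz L (γ r) a) t := by
  have hy : ∀ a, ContDiffOn ℝ ∞ (fun r => dLy L (γ r) a) J := fun a =>
    contDiffOn_fderiv_comp_apply hΩ hL hγ hmem _
  have hz : ∀ a, ContDiffOn ℝ ∞ (fun r => dLz L (γ r) a) J := fun a =>
    contDiffOn_fderiv_comp_apply hΩ hL hγ hmem _
  have hz' : ∀ a, ContDiffOn ℝ ∞ (deriv fun r => dLz L (γ r) a) J := fun a =>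
    (hz a).deriv_of_isOpen hJ (by simp)
  have hp : ∀ t ∈ J, ∀ a, HasDerivAt
      (fun r => dLy L (γ r) a - deriv (fun r => dLz L (γ r) a) r)
      (deriv (fun r => dLy L (γ r) a) t - deriv (deriv fun r => dLz L (γ r) a) t) t :=
    fun t ht a => (differentiableAt_of_contDiffOn hJ (hy a) ht).hasDerivAt.sub
      (differentiableAt_of_contDiffOn hJ (hz' a) ht).hasDerivAt
  -- As `J` is open, identities between functions on `J` hold near each of its points and may be
  -- differentiated there.
  have hev : ∀ {t : ℝ}, t ∈ J → ∀ {f g : ℝ → ℝ}, (∀ r ∈ J, f r = g r) → f =ᶠ[𝓝 t] g :=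
    fun ht _ _ h => Filter.eventually_of_mem (hJ.mem_nhds ht) h
  constructor
  · intro h
    have hbar : ∀ t ∈ J, ∀ a, α t (0, Pi.single a 1) = dLz L (γ t) a := fun t ht a =>
      (h t ht).2.2.2.2 a
    have hmom : ∀ t ∈ J, ∀ a,
        α t (Pi.single a 1, 0) = dLy L (γ t) a - deriv (fun r => dLz L (γ r) a) t := by
      intro t ht a
      have h1 : HasDerivAt (fun r => α r (0, Pi.single a 1))
          (-α t (Pi.single a 1, 0) + dLy L (γ t) a) t := (h t ht).2.2.2.1 a
      -- Differentiating the constraint and inserting the `p̄`-equation determines `p`.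
      rw [← (hev ht fun r hr => hbar r hr a).deriv_eq, h1.deriv]
      ring
    refine ⟨fun t ht => ?_, fun t ht a => ⟨hbar t ht a, hmom t ht a⟩⟩
    obtain ⟨h1, h2, h3, -, -⟩ := h t ht
    refine ⟨h1, h2, fun a => ?_⟩
    -- Two expressions for `ṗ`: the derivative of the formula just found for `p`, and the momentum
    -- equation.
    have h4 := (hp t ht a).unique
      ((h3 a).congr_of_eventuallyEq (hev ht fun r hr => (hmom r hr a).symm))
    simp only [mom, hmom t ht, eliminate_momenta_sum] at h4
    linarith
  · rintro ⟨h, hα⟩ t ht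
    obtain ⟨h1, h2, h3⟩ := h t ht
    refine ⟨h1, h2, fun a => ?_, fun a => ?_, fun a => (hα t ht a).1⟩
    · have h4 := (hp t ht a).congr_of_eventuallyEq (hev ht fun r hr => (hα r hr a).2)
      refine h4.congr_deriv ?_
      have e : ∀ c, mom ((γ t).1, ((γ t).2, α t)) c
          = dLy L (γ t) c - deriv (fun r => dLz L (γ r) c) t := fun c => (hα t ht c).2
      simp only [e, eliminate_momenta_sum]
      linarith [h3 a]
    · have h4 := (differentiableAt_of_contDiffOn hJ (hz a) ht).hasDerivAt.congr_of_eventuallyEq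
        (hev ht fun r hr => (hα r hr a).1)
      refine h4.congr_deriv ?_
      rw [show mom ((γ t).1, ((γ t).2, α t)) a
        = dLy L (γ t) a - deriv (fun r => dLz L (γ r) a) t from (hα t ht a).2]
      ring

/-- The covector with prescribed coordinates. -/
def covector (p pbar : ι → ℝ) : ((ι → ℝ) × (ι → ℝ)) →L[ℝ] ℝ :=
  ∑ a, (p a • (ContinuousLinearMap.proj a).comp (ContinuousLinearMap.fst ℝ (ι → ℝ) (ι → ℝ))
    + pbar a • (ContinuousLinearMap.proj a).comp (ContinuousLinearMap.snd ℝ (ι → ℝ) (ι → ℝ)))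

theorem covector_single_left (p pbar : ι → ℝ) (a : ι) :
    covector p pbar (Pi.single a 1, 0) = p a := by
  simp [covector, Pi.single_apply]

theorem covector_single_right (p pbar : ι → ℝ) (a : ι) :
    covector p pbar (0, Pi.single a 1) = pbar a := by
  simp [covector, Pi.single_apply]

/-- The momenta are forced by the curve in `E⁽²⁾`, and the forced values are smooth functions of
time, so they serve as the witness. -/
theorem exists_momenta_iff (A : LocalAlgebroid (EuclideanSpace ℝ (Fin m)) (ι → ℝ))
    {L : (EuclideanSpace ℝ (Fin m) × (ι → ℝ)) × (ι → ℝ) → ℝ}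
    {Ω : Set ((EuclideanSpace ℝ (Fin m) × (ι → ℝ)) × (ι → ℝ))} (hΩ : IsOpen Ω)
    (hL : ContDiffOn ℝ ∞ L Ω) {J : Set ℝ} (hJ : IsOpen J)
    {γ : ℝ → (EuclideanSpace ℝ (Fin m) × (ι → ℝ)) × (ι → ℝ)}
    (hγ : ContDiffOn ℝ ∞ γ J) (hmem : ∀ t ∈ J, γ t ∈ Ω) :
    (∃ α : ℝ → ((ι → ℝ) × (ι → ℝ)) →L[ℝ] ℝ, ContDiffOn ℝ ∞ α J ∧
      A.MomentumEquations L J (fun t => ((γ t).1, ((γ t).2, α t)))) ↔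
      A.SecondOrderEulerLagrange L J γ := by
  constructor
  · rintro ⟨α, -, h⟩
    exact ((A.momentumEquations_iff hΩ hL hJ hγ hmem α).mp h).1
  · intro h
    have hz : ∀ a, ContDiffOn ℝ ∞ (fun r => dLz L (γ r) a) J := fun a =>
      contDiffOn_fderiv_comp_apply hΩ hL hγ hmem _
    refine ⟨fun t => covector (fun a => dLy L (γ t) a - deriv (fun r => dLz L (γ r) a) t)
      (fun a => dLz L (γ t) a), ?_, (A.momentumEquations_iff hΩ hL hJ hγ hmem _).mpr
        ⟨h, fun t _ a => ⟨covector_single_right _ _ a, covector_single_left _ _ a⟩⟩⟩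
    refine ContDiffOn.sum fun a _ => ContDiffOn.add ?_ ?_
    · exact ((contDiffOn_fderiv_comp_apply hΩ hL hγ hmem _).sub
        ((hz a).deriv_of_isOpen hJ (by simp))).smul contDiffOn_const
    · exact (hz a).smul contDiffOn_const

end Coordinates

end LocalAlgebroid

/-! ### Derivatives of linear families, and charts of a product -/

theorem hasFDerivAt_linear_family {E₁ E₂ E₃ : Type*} {d : ℕ} [NormedAddCommGroup E₁]
    [NormedSpace ℝ E₁] [NormedAddCommGroup E₂] [NormedSpace ℝ E₂] [NormedAddCommGroup E₃]
    [NormedSpace ℝ E₃] (W : EuclideanSpace ℝ (Fin d) →ₗ[ℝ] E₂ → E₃)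
    {ζ : E₁ → EuclideanSpace ℝ (Fin d)} {x : E₁} {y : E₂} (hW : ∀ v, DifferentiableAt ℝ (W v) y)
    (hζ : DifferentiableAt ℝ ζ x) :
    ∃ D : E₁ × E₂ →L[ℝ] E₃, HasFDerivAt (fun p : E₁ × E₂ => W (ζ p.1) p.2) D (x, y) ∧
      ∀ v, D v = W (fderiv ℝ ζ x v.1) y + fderiv ℝ (W (ζ x)) y v.2 := by
  -- Expanding in the standard basis writes `W (ζ x) y` as a finite sum of products `ζ_i(x) W_i(y)`,
  -- to which the product rule applies. No topology on the space of functions containing the values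
  -- of `W` is needed.
  have hsum : ∀ (v : EuclideanSpace ℝ (Fin d)), W v = ∑ i, v i • W (EuclideanSpace.single i 1) := by
    intro v
    conv_lhs => rw [← (EuclideanSpace.basisFun (Fin d) ℝ).sum_repr v]
    simp
  have h1 : ∀ i, HasFDerivAt (fun p : E₁ × E₂ => ζ p.1 i)
      (((EuclideanSpace.proj i).comp (fderiv ℝ ζ x)).comp (ContinuousLinearMap.fst ℝ E₁ E₂))
      (x, y) := fun i =>
    HasFDerivAt.comp (g := fun x => ζ x i) (f := Prod.fst) (x, y)
      ((EuclideanSpace.proj (𝕜 := ℝ) i).hasFDerivAt.comp x hζ.hasFDerivAt) hasFDerivAt_fst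
  have h2 : ∀ i, HasFDerivAt (fun p : E₁ × E₂ => W (EuclideanSpace.single i 1) p.2)
      ((fderiv ℝ (W (EuclideanSpace.single i 1)) y).comp (ContinuousLinearMap.snd ℝ E₁ E₂))
      (x, y) := fun i =>
    HasFDerivAt.comp (g := W (EuclideanSpace.single i 1)) (f := Prod.snd) (x, y)
      (hW _).hasFDerivAt hasFDerivAt_snd
  have h3 := HasFDerivAt.fun_sum (u := Finset.univ) fun i _ => (h1 i).smul (h2 i)
  refine ⟨_, h3.congr_of_eventuallyEq (Filter.Eventually.of_forall fun p => ?_), fun v => ?_⟩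
  · change W (ζ p.1) p.2 = _
    rw [hsum]
    simp
  · have h4 : fderiv ℝ (W (ζ x)) y v.2
        = ∑ i, ζ x i • fderiv ℝ (W (EuclideanSpace.single i 1)) y v.2 := by
      rw [hsum, fderiv_sum fun i _ => (hW _).const_smul _]
      simp [fderiv_const_smul (hW _)]
    rw [h4, hsum]
    simp [Finset.sum_add_distrib, add_comm]

theorem inverse_id_prodMap {E₁ E₂ E₃ : Type*} [NormedAddCommGroup E₁]
    [NormedSpace ℝ E₁] [NormedAddCommGroup E₂] [NormedSpace ℝ E₂] [NormedAddCommGroup E₃]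
    [NormedSpace ℝ E₃] {A : E₂ →L[ℝ] E₃} (hA : A.IsInvertible) :
    ((ContinuousLinearMap.id ℝ E₁).prodMap A).inverse
      = (ContinuousLinearMap.id ℝ E₁).prodMap A.inverse := by
  refine ContinuousLinearMap.inverse_eq ?_ ?_
  · ext v <;> simp [hA.self_apply_inverse]
  · ext v <;> simp [hA.inverse_apply_self]

section Product

variable {m d : ℕ} {G : Type*} [TopologicalSpace G] [ChartedSpace (EuclideanSpace ℝ (Fin d)) G]

/-- The chart of `ℝᵐ × G` at `p` is the identity on the first factor times the chart of `G`, so its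
derivatives are block diagonal. -/
theorem mfderivWithin_extChartAt_symm_prod [IsManifold (𝓡 d) 1 G]
    (p : EuclideanSpace ℝ (Fin m) × G) {z : EuclideanSpace ℝ (Fin m) × EuclideanSpace ℝ (Fin d)}
    (hz : z.2 ∈ (extChartAt (𝓡 d) p.2).target) :
    (mfderivWithin 𝓘(ℝ, EuclideanSpace ℝ (Fin m) × EuclideanSpace ℝ (Fin d)) ((𝓡 m).prod (𝓡 d))
      (extChartAt ((𝓡 m).prod (𝓡 d)) p).symm (range ((𝓡 m).prod (𝓡 d))) z :
        EuclideanSpace ℝ (Fin m) × EuclideanSpace ℝ (Fin d) →L[ℝ]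
          EuclideanSpace ℝ (Fin m) × EuclideanSpace ℝ (Fin d))
    = (ContinuousLinearMap.id ℝ (EuclideanSpace ℝ (Fin m))).prodMap
      (mfderivWithin 𝓘(ℝ, EuclideanSpace ℝ (Fin d)) (𝓡 d) (extChartAt (𝓡 d) p.2).symm
        (range (𝓡 d)) z.2) := by
  rw [ModelWithCorners.range_eq_univ, ModelWithCorners.range_eq_univ, mfderivWithin_univ,
    mfderivWithin_univ]
  have hfun : ((extChartAt ((𝓡 m).prod (𝓡 d)) p).symm :
      EuclideanSpace ℝ (Fin m) × EuclideanSpace ℝ (Fin d) → EuclideanSpace ℝ (Fin m) × G)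
      = fun z => (z.1, (extChartAt (𝓡 d) p.2).symm z.2) := by
    rw [extChartAt_prod]
    rfl
  have h1 : HasMFDerivAt 𝓘(ℝ, EuclideanSpace ℝ (Fin m) × EuclideanSpace ℝ (Fin d)) (𝓡 m)
      (Prod.fst : EuclideanSpace ℝ (Fin m) × EuclideanSpace ℝ (Fin d) → _) z
      (ContinuousLinearMap.fst ℝ (EuclideanSpace ℝ (Fin m)) (EuclideanSpace ℝ (Fin d))) :=
    hasFDerivAt_fst.hasMFDerivAt
  have h2 : HasMFDerivAt 𝓘(ℝ, EuclideanSpace ℝ (Fin m) × EuclideanSpace ℝ (Fin d))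
      𝓘(ℝ, EuclideanSpace ℝ (Fin d))
      (Prod.snd : EuclideanSpace ℝ (Fin m) × EuclideanSpace ℝ (Fin d) → _) z
      (ContinuousLinearMap.snd ℝ (EuclideanSpace ℝ (Fin m)) (EuclideanSpace ℝ (Fin d))) :=
    hasFDerivAt_snd.hasMFDerivAt
  have h3 : MDifferentiableAt 𝓘(ℝ, EuclideanSpace ℝ (Fin d)) (𝓡 d)
      (extChartAt (𝓡 d) p.2).symm z.2 := by
    have := mdifferentiableWithinAt_extChartAt_symm hz
    rwa [ModelWithCorners.range_eq_univ, mdifferentiableWithinAt_univ] at this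
  have h4 := h1.prodMk (h3.hasMFDerivAt.comp z h2)
  rw [hfun]
  exact h4.mfderiv

theorem mfderiv_extChartAt_prod [IsManifold (𝓡 d) 1 G] (p : EuclideanSpace ℝ (Fin m) × G) :
    (mfderiv ((𝓡 m).prod (𝓡 d)) 𝓘(ℝ, EuclideanSpace ℝ (Fin m) × EuclideanSpace ℝ (Fin d))
      (extChartAt ((𝓡 m).prod (𝓡 d)) p) p :
        EuclideanSpace ℝ (Fin m) × EuclideanSpace ℝ (Fin d) →L[ℝ]
          EuclideanSpace ℝ (Fin m) × EuclideanSpace ℝ (Fin d))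
    = (ContinuousLinearMap.id ℝ (EuclideanSpace ℝ (Fin m))).prodMap
      (mfderiv (𝓡 d) 𝓘(ℝ, EuclideanSpace ℝ (Fin d)) (extChartAt (𝓡 d) p.2) p.2) := by
  have hfun : (extChartAt ((𝓡 m).prod (𝓡 d)) p :
      EuclideanSpace ℝ (Fin m) × G → EuclideanSpace ℝ (Fin m) × EuclideanSpace ℝ (Fin d))
      = fun q => (q.1, extChartAt (𝓡 d) p.2 q.2) := by
    rw [extChartAt_prod]
    rfl
  have h3 : MDifferentiableAt (𝓡 d) 𝓘(ℝ, EuclideanSpace ℝ (Fin d)) (extChartAt (𝓡 d) p.2) p.2 :=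
    mdifferentiableAt_extChartAt (mem_chart_source _ _)
  have h4 := HasMFDerivAt.prodMk (hasMFDerivAt_fst (I := 𝓡 m) (I' := 𝓡 d) p)
    (h3.hasMFDerivAt.comp p (hasMFDerivAt_snd (I := 𝓡 m) (I' := 𝓡 d) p))
  rw [hfun, modelWithCornersSelf_prod, ← chartedSpaceSelf_prod]
  exact h4.mfderiv

end Product

/-! ### Brackets of invariant vector fields on `ℝᵐ × G` -/

section Invariant

variable {m d : ℕ} {G : Type*} [TopologicalSpace G] [ChartedSpace (EuclideanSpace ℝ (Fin d)) G]
  [Group G]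

/-- The derivative of a `𝔤`-valued function. -/
def lieAlgebraDeriv (ζ : EuclideanSpace ℝ (Fin m) → GroupLieAlgebra (𝓡 d) G)
    (x u : EuclideanSpace ℝ (Fin m)) : GroupLieAlgebra (𝓡 d) G :=
  fderiv (F := EuclideanSpace ℝ (Fin d)) ℝ ζ x u

/-- The invariant vector field `(u, T_eL_g(ζ(x)))` on the trivial principal bundle. -/
def invariantField (u : EuclideanSpace ℝ (Fin m))
    (ζ : EuclideanSpace ℝ (Fin m) → GroupLieAlgebra (𝓡 d) G) (p : EuclideanSpace ℝ (Fin m) × G) :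
    TangentSpace ((𝓡 m).prod (𝓡 d)) p :=
  (u, mulInvariantVectorField (ζ p.1) p.2)

/-- The left-invariant vector field `ξ` in the chart at the identity. -/
def invariantFieldInChart (G : Type*) [TopologicalSpace G]
    [ChartedSpace (EuclideanSpace ℝ (Fin d)) G] [Group G] (ξ y : EuclideanSpace ℝ (Fin d)) :
    EuclideanSpace ℝ (Fin d) :=
  VectorField.mpullbackWithin 𝓘(ℝ, EuclideanSpace ℝ (Fin d)) (𝓡 d) (extChartAt (𝓡 d) (1 : G)).symm
    (mulInvariantVectorField (show GroupLieAlgebra (𝓡 d) G from ξ)) (range (𝓡 d)) y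

/-- `invariantFieldInChart` as a linear map in the element of the Lie algebra. -/
def invariantFieldInChartLinear (G : Type*) [TopologicalSpace G]
    [ChartedSpace (EuclideanSpace ℝ (Fin d)) G] [Group G] :
    EuclideanSpace ℝ (Fin d) →ₗ[ℝ] EuclideanSpace ℝ (Fin d) → EuclideanSpace ℝ (Fin d) where
  toFun ξ := invariantFieldInChart G ξ
  map_add' ξ η := by
    ext1 y
    exact (congrArg (fun V => VectorField.mpullbackWithin 𝓘(ℝ, EuclideanSpace ℝ (Fin d)) (𝓡 d)
      (extChartAt (𝓡 d) (1 : G)).symm V (range (𝓡 d)) y)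
      (mulInvariantVectorField_add (I := 𝓡 d) (G := G) ξ η)).trans
        VectorField.mpullbackWithin_add_apply
  map_smul' c ξ := by
    ext1 y
    exact (congrArg (fun V => VectorField.mpullbackWithin 𝓘(ℝ, EuclideanSpace ℝ (Fin d)) (𝓡 d)
      (extChartAt (𝓡 d) (1 : G)).symm V (range (𝓡 d)) y)
      (mulInvariantVectorField_smul (I := 𝓡 d) (G := G) c ξ)).trans
        VectorField.mpullbackWithin_const_smul_apply

variable [LieGroup (𝓡 d) ∞ G]

/-- Differentiability of invariant fields and the Lie algebra laws of `GroupLieAlgebra` (`neg_lie`,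
`sum_lie`, `lie_skew`) are stated for this smoothness class; every later appeal to them passes
through this instance. -/
theorem lieGroup_minSmoothness : LieGroup (𝓡 d) (minSmoothness ℝ 3) G :=
  LieGroup.of_le (m := minSmoothness ℝ 3) (n := ∞) (by simpa using ENat.LEInfty.out)

theorem differentiableAt_invariantFieldInChart (ξ : EuclideanSpace ℝ (Fin d)) :
    DifferentiableAt ℝ (invariantFieldInChart G ξ) (extChartAt (𝓡 d) (1 : G) 1) := by
  have := lieGroup_minSmoothness (d := d) (G := G)
  have : IsManifold (𝓡 d) 2 G := inferInstance
  have h := (mdifferentiableAt_mulInvariantVectorField (I := 𝓡 d) (G := G) (g := 1) ξ)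
  have h2 : DifferentiableWithinAt ℝ (invariantFieldInChart G ξ)
      ((extChartAt (𝓡 d) (1 : G)).symm ⁻¹' univ ∩ range (𝓡 d)) (extChartAt (𝓡 d) (1 : G) 1) :=
    (mdifferentiableWithinAt_univ.mpr h).differentiableWithinAt_mpullbackWithin_vectorField
  exact h2.differentiableAt (by simp)

theorem inverse_mfderiv_extChartAt_invariantFieldInChart (ξ : GroupLieAlgebra (𝓡 d) G) :
    (mfderiv (𝓡 d) 𝓘(ℝ, EuclideanSpace ℝ (Fin d)) (extChartAt (𝓡 d) (1 : G)) 1).inverse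
      (invariantFieldInChart G ξ (extChartAt (𝓡 d) (1 : G) 1)) = ξ := by
  have : IsManifold (𝓡 d) 2 G := inferInstance
  have h1 : mulInvariantVectorField ξ (1 : G) = ξ := by
    have : (fun h : G => 1 * h) = id := by ext; simp
    rw [mulInvariantVectorField, this, mfderiv_id]
    rfl
  have h := VectorField.mfderiv_extChartAt_inverse_comp_mfderivWithin_extChartAT_symm
    (I := 𝓡 d) (x := (1 : G)) ξ
  refine Eq.trans ?_ h
  have h2 : ∀ g : G, g = 1 → (mulInvariantVectorField ξ g : EuclideanSpace ℝ (Fin d)) = ξ := by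
    rintro g rfl
    exact h1
  exact congrArg (fun v : EuclideanSpace ℝ (Fin d) =>
    ((mfderiv (𝓡 d) 𝓘(ℝ, EuclideanSpace ℝ (Fin d)) (extChartAt (𝓡 d) (1 : G)) 1).inverse :
      EuclideanSpace ℝ (Fin d) →L[ℝ] EuclideanSpace ℝ (Fin d))
    (((mfderivWithin 𝓘(ℝ, EuclideanSpace ℝ (Fin d)) (𝓡 d) (extChartAt (𝓡 d) (1 : G)).symm
      (range (𝓡 d)) (extChartAt (𝓡 d) (1 : G) 1)) :
      EuclideanSpace ℝ (Fin d) →L[ℝ] EuclideanSpace ℝ (Fin d)).inverse v))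
    (h2 _ (extChartAt_to_inv (I := 𝓡 d) (1 : G)))

/-- The bracket of the Lie algebra is by definition the bracket of left-invariant fields at `1`,
computed in the chart at `1`; only the restriction to a set, here the whole space, has to be
removed. -/
theorem inverse_mfderiv_extChartAt_lieBracket (ξ η : GroupLieAlgebra (𝓡 d) G) :
    (mfderiv (𝓡 d) 𝓘(ℝ, EuclideanSpace ℝ (Fin d)) (extChartAt (𝓡 d) (1 : G)) 1).inverse
      (VectorField.lieBracket ℝ (invariantFieldInChart G ξ) (invariantFieldInChart G η)
        (extChartAt (𝓡 d) (1 : G) 1)) = ⁅ξ, η⁆ := by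
  have h : ∀ V W : EuclideanSpace ℝ (Fin d) → EuclideanSpace ℝ (Fin d),
      VectorField.lieBracket ℝ V W = VectorField.lieBracketWithin ℝ V W
        ((extChartAt (𝓡 d) (1 : G)).symm ⁻¹' univ ∩ range (𝓡 d)) := fun V W => by simp
  exact congrArg (fun v : EuclideanSpace ℝ (Fin d) =>
    ((mfderiv (𝓡 d) 𝓘(ℝ, EuclideanSpace ℝ (Fin d)) (extChartAt (𝓡 d) (1 : G)) 1).inverse :
      EuclideanSpace ℝ (Fin d) →L[ℝ] EuclideanSpace ℝ (Fin d)) v)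
    (congrFun (h (invariantFieldInChart G ξ) (invariantFieldInChart G η)) _)

theorem mpullbackWithin_invariantField (u x : EuclideanSpace ℝ (Fin m))
    (ζ : EuclideanSpace ℝ (Fin m) → GroupLieAlgebra (𝓡 d) G)
    {z : EuclideanSpace ℝ (Fin m) × EuclideanSpace ℝ (Fin d)}
    (hz : z.2 ∈ (extChartAt (𝓡 d) (1 : G)).target) :
    (VectorField.mpullbackWithin 𝓘(ℝ, EuclideanSpace ℝ (Fin m) × EuclideanSpace ℝ (Fin d))
      ((𝓡 m).prod (𝓡 d)) (extChartAt ((𝓡 m).prod (𝓡 d)) (x, (1 : G))).symm (invariantField u ζ)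
      (range ((𝓡 m).prod (𝓡 d))) z : EuclideanSpace ℝ (Fin m) × EuclideanSpace ℝ (Fin d))
    = (u, invariantFieldInChart G (ζ z.1) z.2) := by
  have : IsManifold (𝓡 d) 1 G := inferInstance
  have h1 := mfderivWithin_extChartAt_symm_prod (m := m) (x, (1 : G)) hz
  have h2 := isInvertible_mfderivWithin_extChartAt_symm (I := 𝓡 d) hz
  refine (congrArg (fun A : EuclideanSpace ℝ (Fin m) × EuclideanSpace ℝ (Fin d) →L[ℝ]
    EuclideanSpace ℝ (Fin m) × EuclideanSpace ℝ (Fin d) => A.inverse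
      (u, (mulInvariantVectorField (ζ z.1) ((extChartAt (𝓡 d) (1 : G)).symm z.2) :
        EuclideanSpace ℝ (Fin d)))) h1).trans ?_
  exact (DFunLike.congr_fun (inverse_id_prodMap (E₁ := EuclideanSpace ℝ (Fin m))
    (E₂ := EuclideanSpace ℝ (Fin d)) (E₃ := EuclideanSpace ℝ (Fin d)) h2) _)

/-- An invariant vector field with constant horizontal part, in the chart at `(x, 1)`. -/
def invariantFieldModel (G : Type*) [TopologicalSpace G]
    [ChartedSpace (EuclideanSpace ℝ (Fin d)) G] [Group G] (u : EuclideanSpace ℝ (Fin m))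
    (ζ : EuclideanSpace ℝ (Fin m) → EuclideanSpace ℝ (Fin d))
    (z : EuclideanSpace ℝ (Fin m) × EuclideanSpace ℝ (Fin d)) :
    EuclideanSpace ℝ (Fin m) × EuclideanSpace ℝ (Fin d) :=
  (u, invariantFieldInChartLinear G (ζ z.1) z.2)

/-- The field depends on the base only through `ζ` and linearly on the value of `ζ`. The derivative
along the base therefore gives the invariant field of a derivative of `ζ`, and the derivative along
the group gives the bracket with `ζ` frozen at `x`. -/
theorem lieBracket_invariantFieldModel (u u' x : EuclideanSpace ℝ (Fin m))
    {ζ ζ' : EuclideanSpace ℝ (Fin m) → EuclideanSpace ℝ (Fin d)}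
    (hζ : DifferentiableAt ℝ ζ x) (hζ' : DifferentiableAt ℝ ζ' x) :
    VectorField.lieBracket ℝ (invariantFieldModel G u ζ) (invariantFieldModel G u' ζ')
        (x, extChartAt (𝓡 d) (1 : G) 1)
      = (0, invariantFieldInChartLinear G (fderiv ℝ ζ' x u - fderiv ℝ ζ x u')
            (extChartAt (𝓡 d) (1 : G) 1)
          + VectorField.lieBracket ℝ (invariantFieldInChartLinear G (ζ x))
            (invariantFieldInChartLinear G (ζ' x)) (extChartAt (𝓡 d) (1 : G) 1)) := by
  generalize hy : (extChartAt (𝓡 d) (1 : G) 1 : EuclideanSpace ℝ (Fin d)) = y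
  have hderiv : ∀ (u : EuclideanSpace ℝ (Fin m))
      {ζ : EuclideanSpace ℝ (Fin m) → EuclideanSpace ℝ (Fin d)}, DifferentiableAt ℝ ζ x →
      ∀ v, fderiv ℝ (invariantFieldModel G u ζ) (x, y) v
        = (0, invariantFieldInChartLinear G (fderiv ℝ ζ x v.1) y
          + fderiv ℝ (invariantFieldInChartLinear G (ζ x)) y v.2) := by
    intro u ζ hζ v
    obtain ⟨D, hD, hDv⟩ := hasFDerivAt_linear_family (invariantFieldInChartLinear G) (ζ := ζ)
      (x := x) (y := y) (fun v => hy ▸ differentiableAt_invariantFieldInChart v) hζ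
    have h : HasFDerivAt (invariantFieldModel G u ζ) _ (x, y) :=
      (hasFDerivAt_const u (x, y)).prodMk hD
    rw [h.fderiv]
    simp [hDv]
  rw [VectorField.lieBracket, hderiv _ hζ, hderiv _ hζ', VectorField.lieBracket]
  ext1
  · simp [invariantFieldModel]
  · simp only [invariantFieldModel, Prod.snd_sub, map_sub, Pi.sub_apply]
    abel

theorem lieBracketWithin_mpullbackWithin_invariantField (u u' x : EuclideanSpace ℝ (Fin m))
    (ζ ζ' : EuclideanSpace ℝ (Fin m) → GroupLieAlgebra (𝓡 d) G) :
    VectorField.lieBracketWithin ℝ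
      (VectorField.mpullbackWithin 𝓘(ℝ, EuclideanSpace ℝ (Fin m) × EuclideanSpace ℝ (Fin d))
        ((𝓡 m).prod (𝓡 d)) (extChartAt ((𝓡 m).prod (𝓡 d)) (x, (1 : G))).symm (invariantField u ζ)
        (range ((𝓡 m).prod (𝓡 d))))
      (VectorField.mpullbackWithin 𝓘(ℝ, EuclideanSpace ℝ (Fin m) × EuclideanSpace ℝ (Fin d))
        ((𝓡 m).prod (𝓡 d)) (extChartAt ((𝓡 m).prod (𝓡 d)) (x, (1 : G))).symm (invariantField u' ζ')
        (range ((𝓡 m).prod (𝓡 d))))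
      ((extChartAt ((𝓡 m).prod (𝓡 d)) (x, (1 : G))).symm ⁻¹' univ ∩ range ((𝓡 m).prod (𝓡 d)))
      (extChartAt ((𝓡 m).prod (𝓡 d)) (x, (1 : G)) (x, 1))
    = VectorField.lieBracket ℝ (invariantFieldModel G u ζ) (invariantFieldModel G u' ζ')
        (x, extChartAt (𝓡 d) (1 : G) 1) := by
  have hmem : ∀ᶠ z in 𝓝 ((x, extChartAt (𝓡 d) (1 : G) 1) :
      EuclideanSpace ℝ (Fin m) × EuclideanSpace ℝ (Fin d)),
      z.2 ∈ (extChartAt (𝓡 d) (1 : G)).target :=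
    continuousAt_snd.eventually (extChartAt_target_mem_nhds (I := 𝓡 d) (1 : G))
  -- The two fields are treated as plain vector-valued functions, so that the set and the base point
  -- can be rewritten free of dependent tangent-space types.
  have key : ∀ P P' : EuclideanSpace ℝ (Fin m) × EuclideanSpace ℝ (Fin d) →
      EuclideanSpace ℝ (Fin m) × EuclideanSpace ℝ (Fin d),
      P =ᶠ[𝓝 (x, extChartAt (𝓡 d) (1 : G) 1)] invariantFieldModel G u ζ →
      P' =ᶠ[𝓝 (x, extChartAt (𝓡 d) (1 : G) 1)] invariantFieldModel G u' ζ' →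
      VectorField.lieBracketWithin ℝ P P'
        ((extChartAt ((𝓡 m).prod (𝓡 d)) (x, (1 : G))).symm ⁻¹' univ ∩ range ((𝓡 m).prod (𝓡 d)))
        (extChartAt ((𝓡 m).prod (𝓡 d)) (x, (1 : G)) (x, 1))
      = VectorField.lieBracket ℝ (invariantFieldModel G u ζ) (invariantFieldModel G u' ζ')
        (x, extChartAt (𝓡 d) (1 : G) 1) := by
    intro P P' hP hP'
    have hset : (extChartAt ((𝓡 m).prod (𝓡 d)) (x, (1 : G))).symm ⁻¹' univ
        ∩ range ((𝓡 m).prod (𝓡 d)) = univ := by simp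
    have hbase : extChartAt ((𝓡 m).prod (𝓡 d)) (x, (1 : G)) (x, 1)
        = (x, extChartAt (𝓡 d) (1 : G) 1) := by
      rw [extChartAt_prod]
      rfl
    rw [hset, hbase, VectorField.lieBracketWithin_univ]
    exact hP.lieBracket_vectorField_eq hP'
  exact key _ _ (hmem.mono fun z hz => mpullbackWithin_invariantField u x ζ hz)
    (hmem.mono fun z hz => mpullbackWithin_invariantField u' x ζ' hz)

/-- The Lie bracket, at `(x, 1)`, of two invariant vector fields on the trivial principal bundle
`ℝᵐ × G → ℝᵐ` with constant horizontal parts. -/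
theorem mlieBracket_invariantField (u u' : EuclideanSpace ℝ (Fin m))
    (ζ ζ' : EuclideanSpace ℝ (Fin m) → GroupLieAlgebra (𝓡 d) G)
    (x : EuclideanSpace ℝ (Fin m))
    (hζ : DifferentiableAt (F := EuclideanSpace ℝ (Fin d)) ℝ ζ x)
    (hζ' : DifferentiableAt (F := EuclideanSpace ℝ (Fin d)) ℝ ζ' x) :
    VectorField.mlieBracket ((𝓡 m).prod (𝓡 d)) (invariantField (G := G) u ζ)
      (invariantField (G := G) u' ζ') (x, (1 : G))
    = ((0, lieAlgebraDeriv ζ' x u - lieAlgebraDeriv ζ x u' + ⁅ζ x, ζ' x⁆) :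
        EuclideanSpace ℝ (Fin m) × GroupLieAlgebra (𝓡 d) G) := by
  have : IsManifold (𝓡 d) 1 G := inferInstance
  -- A manifold bracket is the inverse of the chart derivative applied to the bracket in the chart.
  -- `hinv` handles the former and `hbr` the latter.
  have hinv := (congrArg (fun A : EuclideanSpace ℝ (Fin m) × EuclideanSpace ℝ (Fin d) →L[ℝ]
    EuclideanSpace ℝ (Fin m) × EuclideanSpace ℝ (Fin d) => A.inverse)
    (mfderiv_extChartAt_prod (m := m) (x, (1 : G)))).trans
      (inverse_id_prodMap (E₂ := EuclideanSpace ℝ (Fin d)) (E₃ := EuclideanSpace ℝ (Fin d))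
        (isInvertible_mfderiv_extChartAt (I := 𝓡 d) (mem_extChartAt_source (I := 𝓡 d) (1 : G))))
  have hbr := (lieBracketWithin_mpullbackWithin_invariantField u u' x ζ ζ').trans
    (lieBracket_invariantFieldModel (G := G) u u' x hζ hζ')
  refine (congrArg₂ (fun (A : EuclideanSpace ℝ (Fin m) × EuclideanSpace ℝ (Fin d) →L[ℝ]
    EuclideanSpace ℝ (Fin m) × EuclideanSpace ℝ (Fin d)) v => A v) hinv hbr).trans ?_
  refine Prod.ext rfl ?_
  let B : EuclideanSpace ℝ (Fin d) →L[ℝ] EuclideanSpace ℝ (Fin d) :=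
    (mfderiv (𝓡 d) 𝓘(ℝ, EuclideanSpace ℝ (Fin d)) (extChartAt (𝓡 d) (1 : G)) 1).inverse
  refine (map_add B _ _).trans ?_
  exact congrArg₂ (fun v w : EuclideanSpace ℝ (Fin d) => v + w)
    (inverse_mfderiv_extChartAt_invariantFieldInChart (G := G) _)
    (inverse_mfderiv_extChartAt_lieBracket (ζ x) (ζ' x))

end Invariant

/-! ### Brackets of local sections, and the Atiyah trivialization -/

namespace LieAlgebroid

section Frames

variable {m : ℕ} {M : Type*} [TopologicalSpace M]
  [ChartedSpace (EuclideanSpace ℝ (Fin m)) M] [IsManifold (𝓡 m) ∞ M]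
  {F : Type*} [NormedAddCommGroup F] [NormedSpace ℝ F]
  {V : M → Type*} [TopologicalSpace (TotalSpace F V)]
  [∀ x, AddCommGroup (V x)] [∀ x, Module ℝ (V x)] [∀ x, TopologicalSpace (V x)]
  [FiberBundle F V] [VectorBundle ℝ F V]

/-- A smooth bump function supported in `u` and equal to `1` near `x` cuts `σ` off to a global
section, so the default value `0` is not taken. -/
theorem germExtension_eventuallyEq [T2Space M] {σ : ∀ y, V y} {u : Set M} (hu : IsOpen u)
    (hσ : ContMDiffOn (𝓡 m) ((𝓡 m).prod 𝓘(ℝ, F)) ∞ (fun y => (⟨y, σ y⟩ : TotalSpace F V)) u)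
    {x : M} (hx : x ∈ u) :
    ∀ᶠ y in 𝓝 x, (germExtension (m := m) (F := F) σ x) y = σ y := by
  have h : ∃ S : Cₛ^∞⟮𝓡 m; F, V⟯, ∀ᶠ y in 𝓝 x, S y = σ y := by
    obtain ⟨b, -, hb⟩ := (SmoothBumpFunction.nhds_basis_tsupport (I := 𝓡 m) x).mem_iff.mp
      (hu.mem_nhds hx)
    refine ⟨⟨fun y => b y • σ y, ?_⟩, ?_⟩
    · exact ContMDiffOn.smul_section_of_tsupport b.contMDiff.contMDiffOn hu hb hσ
    · filter_upwards [b.eventuallyEq_one] with y hy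
      change b y • σ y = σ y
      rw [hy, Pi.one_apply, one_smul]
  rw [germExtension, dif_pos h]
  exact h.choose_spec

variable {ι : Type*} [Fintype ι]

/-- No condition on `x` is needed: whatever global sections `germExtension` returns, including the
default `0`, their bracket is skew. -/
theorem structureFunction_skew (E : LieAlgebroid m F V) {u : Set M} {s : ι → (x : M) → V x}
    (hs : IsLocalFrameOn (𝓡 m) F ∞ s u) (a b c : ι) (x : M) :
    E.structureFunction hs a b c x = -E.structureFunction hs b a c x := by
  rw [structureFunction, E.bracket_skew]
  exact map_neg (hs.coeff c x) _

theorem structFn_restrict [DecidableEq ι] (E : LieAlgebroid m F V)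
    {φ : OpenPartialHomeomorph M (EuclideanSpace ℝ (Fin m))}
    {s : ι → (x : M) → V x} (hs : IsLocalFrameOn (𝓡 m) F ∞ s φ.source)
    (x : EuclideanSpace ℝ (Fin m)) (a b c : ι) :
    (E.restrict φ hs).structFn x a b c = E.structureFunction hs a b c (φ.symm x) := by
  simp [LocalAlgebroid.structFn, restrict, Pi.single_apply]

theorem isSkewAt_restrict [DecidableEq ι] (E : LieAlgebroid m F V)
    {φ : OpenPartialHomeomorph M (EuclideanSpace ℝ (Fin m))}
    {s : ι → (x : M) → V x} (hs : IsLocalFrameOn (𝓡 m) F ∞ s φ.source)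
    (x : EuclideanSpace ℝ (Fin m)) : (E.restrict φ hs).IsSkewAt x := fun a b c => by
  rw [structFn_restrict, structFn_restrict, structureFunction_skew]

end Frames

namespace AtiyahTrivialization

variable {m : ℕ} {M : Type*} [TopologicalSpace M]
  [ChartedSpace (EuclideanSpace ℝ (Fin m)) M] [IsManifold (𝓡 m) ∞ M]
  {F : Type*} [NormedAddCommGroup F] [NormedSpace ℝ F]
  {V : M → Type*} [TopologicalSpace (TotalSpace F V)]
  [∀ x, AddCommGroup (V x)] [∀ x, Module ℝ (V x)] [∀ x, TopologicalSpace (V x)]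
  [FiberBundle F V] [VectorBundle ℝ F V] {E : LieAlgebroid m F V}
  {φ : OpenPartialHomeomorph M (EuclideanSpace ℝ (Fin m))} {d : ℕ} {G : Type*}
  [TopologicalSpace G] [ChartedSpace (EuclideanSpace ℝ (Fin d)) G] [Group G]

/-- Near `(x, 1)`, the invariant vector field of a section that is `(u, ζ)` near `x`. -/
theorem eventuallyEq_invariantField (T : E.AtiyahTrivialization φ d G) {σ : Cₛ^∞⟮𝓡 m; F, V⟯}
    {x : EuclideanSpace ℝ (Fin m)} (hx : x ∈ φ.target) {u : EuclideanSpace ℝ (Fin m)}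
    {ζ : EuclideanSpace ℝ (Fin m) → GroupLieAlgebra (𝓡 d) G}
    (hσ : ∀ᶠ y in 𝓝 (φ.symm x), T.toFun y (σ y) = (u, ζ (φ y))) :
    (fun p : EuclideanSpace ℝ (Fin m) × G => (((T.toFun (φ.symm p.1) (σ (φ.symm p.1))).1,
        mulInvariantVectorField (T.toFun (φ.symm p.1) (σ (φ.symm p.1))).2 p.2) :
          TangentSpace ((𝓡 m).prod (𝓡 d)) p)) =ᶠ[𝓝 (x, 1)] invariantField u ζ := by
  have h1 : ∀ᶠ x' in 𝓝 x, T.toFun (φ.symm x') (σ (φ.symm x')) = (u, ζ x') := by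
    filter_upwards [(φ.continuousAt_symm hx).eventually hσ, φ.open_target.mem_nhds hx] with x' h h'
    rw [h, φ.right_inv h']
  filter_upwards [(continuousAt_fst (p := ((x, 1) : EuclideanSpace ℝ (Fin m) × G))).eventually h1]
    with p hp
  exact congrArg (fun v : EuclideanSpace ℝ (Fin m) × GroupLieAlgebra (𝓡 d) G =>
    ((v.1, mulInvariantVectorField v.2 p.2) : EuclideanSpace ℝ (Fin m) × TangentSpace (𝓡 d) p.2)) hp

/-- The bracket of vector fields depends only on germs, so near `(x, 1)` the fields may be replaced
by model ones; at `g = 1` left translation is the identity, and `bracket_eq` becomes a formula in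
`ℝᵐ × 𝔤`. -/
theorem toFun_bracket [LieGroup (𝓡 d) ∞ G] (T : E.AtiyahTrivialization φ d G)
    {σ τ : Cₛ^∞⟮𝓡 m; F, V⟯} {x : EuclideanSpace ℝ (Fin m)} (hx : x ∈ φ.target)
    {u u' : EuclideanSpace ℝ (Fin m)}
    {ζ ζ' : EuclideanSpace ℝ (Fin m) → GroupLieAlgebra (𝓡 d) G}
    (hζ : DifferentiableAt (F := EuclideanSpace ℝ (Fin d)) ℝ ζ x)
    (hζ' : DifferentiableAt (F := EuclideanSpace ℝ (Fin d)) ℝ ζ' x)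
    (hσ : ∀ᶠ y in 𝓝 (φ.symm x), T.toFun y (σ y) = (u, ζ (φ y)))
    (hτ : ∀ᶠ y in 𝓝 (φ.symm x), T.toFun y (τ y) = (u', ζ' (φ y))) :
    T.toFun (φ.symm x) (E.bracket σ τ (φ.symm x))
      = (0, lieAlgebraDeriv ζ' x u - lieAlgebraDeriv ζ x u' + ⁅ζ x, ζ' x⁆) := by
  have h1 := T.bracket_eq σ τ x hx 1
  have h2 := (T.eventuallyEq_invariantField hx hσ).mlieBracket_vectorField_eq
    (T.eventuallyEq_invariantField hx hτ)
  have h3 := mlieBracket_invariantField u u' ζ ζ' x hζ hζ'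
  have h4 := h1.symm.trans (h2.trans h3)
  have h5 : ∀ η : GroupLieAlgebra (𝓡 d) G, mulInvariantVectorField η (1 : G) = η := by
    intro η
    have : (fun h : G => 1 * h) = id := by ext; simp
    rw [mulInvariantVectorField, this, mfderiv_id]
    rfl
  have h6 := Prod.ext_iff.mp h4
  exact Prod.ext h6.1 ((h5 _).symm.trans h6.2)

variable {ι : Type*} [Fintype ι] [DecidableEq ι] {s : ι → (x : M) → V x}

theorem rho_restrict (T : E.AtiyahTrivialization φ d G) (hs : IsLocalFrameOn (𝓡 m) F ∞ s φ.source)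
    {x : EuclideanSpace ℝ (Fin m)} (hx : x ∈ φ.target) (i : Fin m) (a : ι) :
    (E.restrict φ hs).rho x i a = (T.toFun (φ.symm x) (s a (φ.symm x))).1 i := by
  have h : Fintype.linearCombination ℝ (fun a => s a (φ.symm x)) (Pi.single a 1)
      = s a (φ.symm x) := by simp
  rw [T.anchor_eq _ (φ.map_target hx)]
  simp only [LocalAlgebroid.rho, restrict]
  exact congrArg (fun v => (show EuclideanSpace ℝ (Fin m) from
    mfderiv (𝓡 m) (𝓡 m) φ (φ.symm x) (E.anchor (φ.symm x) v)) i) h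

/-- The horizontal parts of the adapted frame. -/
def frameHorizontal (m d : ℕ) : Fin m ⊕ Fin d → EuclideanSpace ℝ (Fin m) :=
  Sum.elim (fun i => EuclideanSpace.single i 1) 0

/-- The vertical parts of the adapted frame. -/
def frameVertical {U : Set (EuclideanSpace ℝ (Fin m))}
    (ξ : Module.Basis (Fin d) ℝ (GroupLieAlgebra (𝓡 d) G)) (𝒜 : PrincipalConnection U d G) :
    Fin m ⊕ Fin d → EuclideanSpace ℝ (Fin m) → GroupLieAlgebra (𝓡 d) G :=
  Sum.elim (fun i x => -𝒜.value x i) (fun B _ => ξ B)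

/-- The trivialization carries the frame `s` to `ê_i = ∂/∂x^i - 𝒜^A_i ξ_A`, `ê_B = ξ_B`. -/
def IsAdaptedFrame (T : E.AtiyahTrivialization φ d G)
    (ξ : Module.Basis (Fin d) ℝ (GroupLieAlgebra (𝓡 d) G))
    (𝒜 : PrincipalConnection φ.target d G) (κ : Fin m ⊕ Fin d ≃ ι) (s : ι → (x : M) → V x) : Prop :=
  ∀ x ∈ φ.source, ∀ k, T.toFun x (s (κ k) x) = (frameHorizontal m d k, frameVertical ξ 𝒜 k (φ x))

variable {T : E.AtiyahTrivialization φ d G}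
  {ξ : Module.Basis (Fin d) ℝ (GroupLieAlgebra (𝓡 d) G)} {𝒜 : PrincipalConnection φ.target d G}
  {κ : Fin m ⊕ Fin d ≃ ι}

theorem differentiableAt_value (𝒜 : PrincipalConnection φ.target d G)
    {x : EuclideanSpace ℝ (Fin m)} (hx : x ∈ φ.target) (i : Fin m) :
    DifferentiableAt (F := EuclideanSpace ℝ (Fin d)) ℝ (fun x => 𝒜.value x i) x :=
  ((𝒜.smooth (EuclideanSpace.single i 1)).contDiffAt
    (φ.open_target.mem_nhds hx)).differentiableAt (by simp)

theorem differentiableAt_frameVertical {x : EuclideanSpace ℝ (Fin m)} (hx : x ∈ φ.target)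
    (k : Fin m ⊕ Fin d) :
    DifferentiableAt (F := EuclideanSpace ℝ (Fin d)) ℝ (frameVertical ξ 𝒜 k) x := by
  rcases k with i | B
  · exact (differentiableAt_value 𝒜 hx i).neg
  · exact differentiableAt_const (F := EuclideanSpace ℝ (Fin d)) _

/-- By injectivity of the trivialization, a vector with zero horizontal part is the combination of
the `ê_A` alone with the coordinates of `η`. -/
theorem coeff_eq (hT : T.IsAdaptedFrame ξ 𝒜 κ s) (hs : IsLocalFrameOn (𝓡 m) F ∞ s φ.source)
    {x : M} (hx : x ∈ φ.source) {b : V x} {η : GroupLieAlgebra (𝓡 d) G}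
    (hb : T.toFun x b = (0, η)) (k : Fin m ⊕ Fin d) :
    hs.coeff (κ k) x b = Sum.elim (fun _ => 0) (fun A => ξ.repr η A) k := by
  have h1 : b = ∑ A, ξ.repr η A • s (κ (Sum.inr A)) x := by
    refine (T.bijective x hx).injective ?_
    rw [hb, map_sum]
    simp only [map_smul, hT x hx]
    refine Prod.ext ?_ ?_
    · simp [frameHorizontal, Prod.fst_sum]
    · rw [Prod.snd_sum]
      exact (ξ.sum_repr η).symm
  have h2 : ∀ a, (hs.toBasisAt hx).repr (s a x) = Finsupp.single a 1 := by
    intro a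
    rw [← hs.toBasisAt_coe hx a]
    exact Module.Basis.repr_self _ _
  have h3 : ∀ a, hs.coeff (κ k) x (s a x) = Finsupp.single a (1 : ℝ) (κ k) := by
    intro a
    rw [hs.coeff_apply_of_mem hx (s a), h2]
  rw [h1, map_sum]
  simp only [map_smul, h3, Finsupp.single_apply, EmbeddingLike.apply_eq_iff_eq]
  rcases k with i | A
  · simp
  · simp

/-- The structure functions in the adapted frame. -/
theorem structFn_restrict [T2Space M] [LieGroup (𝓡 d) ∞ G] [ContMDiffVectorBundle ∞ F V (𝓡 m)]
    (hT : T.IsAdaptedFrame ξ 𝒜 κ s) (hs : IsLocalFrameOn (𝓡 m) F ∞ s φ.source)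
    {x : EuclideanSpace ℝ (Fin m)} (hx : x ∈ φ.target) (k l r : Fin m ⊕ Fin d) :
    (E.restrict φ hs).structFn x (κ k) (κ l) (κ r)
      = Sum.elim (fun _ => 0) (fun A => ξ.repr
        (lieAlgebraDeriv (frameVertical ξ 𝒜 l) x (frameHorizontal m d k)
          - lieAlgebraDeriv (frameVertical ξ 𝒜 k) x (frameHorizontal m d l)
          + ⁅frameVertical ξ 𝒜 k x, frameVertical ξ 𝒜 l x⁆) A) r := by
  rw [LieAlgebroid.structFn_restrict, structureFunction]
  refine coeff_eq hT hs (φ.map_target hx) ?_ r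
  have hev : ∀ k, ∀ᶠ y in 𝓝 (φ.symm x),
      T.toFun y (germExtension (m := m) (F := F) (s (κ k)) (φ.symm x) y)
        = (frameHorizontal m d k, frameVertical ξ 𝒜 k (φ y)) := by
    intro k
    filter_upwards [germExtension_eventuallyEq φ.open_source (hs.contMDiffOn (κ k))
      (φ.map_target hx), φ.open_source.mem_nhds (φ.map_target hx)] with y hy hy'
    rw [hy, hT y hy']
  exact T.toFun_bracket hx (differentiableAt_frameVertical hx k)
    (differentiableAt_frameVertical hx l) (hev k) (hev l)

theorem fderiv_coeff {x : EuclideanSpace ℝ (Fin m)} (hx : x ∈ φ.target) (i : Fin m)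
    (A : Fin d) (v : EuclideanSpace ℝ (Fin m)) :
    fderiv ℝ (fun x' => 𝒜.coeff ξ x' i A) x v
      = ξ.repr (lieAlgebraDeriv (fun x => 𝒜.value x i) x v) A := by
  -- A coordinate functional on the finite-dimensional `𝔤` is continuous, hence commutes with
  -- differentiation.
  let ℓ : EuclideanSpace ℝ (Fin d) →L[ℝ] ℝ := LinearMap.toContinuousLinearMap
    ((ξ.coord A : GroupLieAlgebra (𝓡 d) G →ₗ[ℝ] ℝ) : EuclideanSpace ℝ (Fin d) →ₗ[ℝ] ℝ)
  have h : HasFDerivAt (fun x' => 𝒜.coeff ξ x' i A) _ x :=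
    ℓ.hasFDerivAt.comp x (differentiableAt_value 𝒜 hx i).hasFDerivAt
  rw [h.fderiv]
  rfl

theorem lieAlgebraDeriv_frameVertical_inl (i : Fin m) (x v : EuclideanSpace ℝ (Fin m)) :
    lieAlgebraDeriv (frameVertical ξ 𝒜 (Sum.inl i)) x v
      = -lieAlgebraDeriv (fun x => 𝒜.value x i) x v :=
  DFunLike.congr_fun (fderiv_fun_neg (F := EuclideanSpace ℝ (Fin d)) (𝕜 := ℝ)
    (f := fun x => 𝒜.value x i) (x := x)) v

theorem lieAlgebraDeriv_frameVertical_inr (B : Fin d) (x v : EuclideanSpace ℝ (Fin m)) :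
    lieAlgebraDeriv (frameVertical ξ 𝒜 (Sum.inr B)) x v = 0 :=
  DFunLike.congr_fun (congrFun (fderiv_fun_const (F := EuclideanSpace ℝ (Fin d)) (𝕜 := ℝ)
    (ξ B)) x) v

end AtiyahTrivialization

end LieAlgebroid

/-! ### Anchor and structure functions in the adapted frame -/

namespace LieAlgebroid.AtiyahTrivialization

variable {m : ℕ} {M : Type*} [TopologicalSpace M] [T2Space M]
  [ChartedSpace (EuclideanSpace ℝ (Fin m)) M] [IsManifold (𝓡 m) ∞ M]
  {F : Type*} [NormedAddCommGroup F] [NormedSpace ℝ F]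
  {V : M → Type*} [TopologicalSpace (TotalSpace F V)]
  [∀ x, AddCommGroup (V x)] [∀ x, Module ℝ (V x)] [∀ x, TopologicalSpace (V x)]
  [FiberBundle F V] [VectorBundle ℝ F V] [ContMDiffVectorBundle ∞ F V (𝓡 m)]
  {E : LieAlgebroid m F V}
  {φ : OpenPartialHomeomorph M (EuclideanSpace ℝ (Fin m))} {d : ℕ} {G : Type*}
  [TopologicalSpace G] [ChartedSpace (EuclideanSpace ℝ (Fin d)) G] [Group G] [LieGroup (𝓡 d) ∞ G]
  {ι : Type*} [Fintype ι] [DecidableEq ι] {s : ι → (x : M) → V x}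
  {T : E.AtiyahTrivialization φ d G}
  {ξ : Module.Basis (Fin d) ℝ (GroupLieAlgebra (𝓡 d) G)} {𝒜 : PrincipalConnection φ.target d G}
  {κ : Fin m ⊕ Fin d ≃ ι}

theorem value_eq_sum (x : EuclideanSpace ℝ (Fin m)) (i : Fin m) :
    𝒜.value x i = ∑ D, 𝒜.coeff ξ x i D • ξ D := (ξ.sum_repr _).symm

theorem structFn_inr_inr (hT : T.IsAdaptedFrame ξ 𝒜 κ s)
    (hs : IsLocalFrameOn (𝓡 m) F ∞ s φ.source) {x : EuclideanSpace ℝ (Fin m)} (hx : x ∈ φ.target)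
    (B D A : Fin d) :
    (E.restrict φ hs).structFn x (κ (Sum.inr B)) (κ (Sum.inr D)) (κ (Sum.inr A))
      = structureConstant ξ B D A := by
  rw [structFn_restrict hT hs hx, lieAlgebraDeriv_frameVertical_inr,
    lieAlgebraDeriv_frameVertical_inr, sub_self, zero_add]
  rfl

theorem structFn_inl_inr (hT : T.IsAdaptedFrame ξ 𝒜 κ s)
    (hs : IsLocalFrameOn (𝓡 m) F ∞ s φ.source) {x : EuclideanSpace ℝ (Fin m)} (hx : x ∈ φ.target)
    (i : Fin m) (B A : Fin d) :
    (E.restrict φ hs).structFn x (κ (Sum.inl i)) (κ (Sum.inr B)) (κ (Sum.inr A))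
      = -∑ D, 𝒜.coeff ξ x i D * structureConstant ξ D B A := by
  have := lieGroup_minSmoothness (d := d) (G := G)
  have h0 : lieAlgebraDeriv (frameVertical ξ 𝒜 (Sum.inl i)) x (frameHorizontal m d (Sum.inr B))
      = 0 := map_zero (fderiv (F := EuclideanSpace ℝ (Fin d)) ℝ (frameVertical ξ 𝒜 (Sum.inl i)) x)
  rw [structFn_restrict hT hs hx, lieAlgebraDeriv_frameVertical_inr, h0, sub_self, zero_add]
  change ξ.repr ⁅-𝒜.value x i, ξ B⁆ A = _
  rw [neg_lie, value_eq_sum (ξ := ξ), sum_lie]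
  simp [structureConstant]

/-- With `ζ = -𝒜_i` and `ζ' = -𝒜_j` the derivative terms change sign but the bracket, being
quadratic, does not; this matches the minus sign of the quadratic term in `ℬ`. -/
theorem structFn_inl_inl (hT : T.IsAdaptedFrame ξ 𝒜 κ s)
    (hs : IsLocalFrameOn (𝓡 m) F ∞ s φ.source) {x : EuclideanSpace ℝ (Fin m)} (hx : x ∈ φ.target)
    (i j : Fin m) (A : Fin d) :
    (E.restrict φ hs).structFn x (κ (Sum.inl i)) (κ (Sum.inl j)) (κ (Sum.inr A))
      = -𝒜.curvature ξ x i j A := by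
  have := lieGroup_minSmoothness (d := d) (G := G)
  have h1 : ξ.repr ⁅𝒜.value x i, 𝒜.value x j⁆ A
      = ∑ B, ∑ C, structureConstant ξ B C A * 𝒜.coeff ξ x i B * 𝒜.coeff ξ x j C := by
    rw [value_eq_sum (ξ := ξ) x i, value_eq_sum (ξ := ξ) x j, sum_lie]
    simp only [lie_sum, smul_lie, lie_smul, map_sum, map_smul, Finsupp.coe_finsetSum,
      Finset.sum_apply, Finsupp.smul_apply, smul_eq_mul, structureConstant]
    refine Finset.sum_congr rfl fun B _ => Finset.sum_congr rfl fun C _ => ?_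
    ring
  rw [structFn_restrict hT hs hx, lieAlgebraDeriv_frameVertical_inl,
    lieAlgebraDeriv_frameVertical_inl]
  change ξ.repr (-lieAlgebraDeriv (fun x => 𝒜.value x j) x (EuclideanSpace.single i 1)
    - -lieAlgebraDeriv (fun x => 𝒜.value x i) x (EuclideanSpace.single j 1)
    + ⁅-𝒜.value x i, -𝒜.value x j⁆) A = _
  rw [neg_lie, lie_neg, neg_neg, PrincipalConnection.curvature, fderiv_coeff hx, fderiv_coeff hx,
    ← h1]
  simp only [map_add, map_sub, map_neg, Finsupp.add_apply, Finsupp.sub_apply, Finsupp.neg_apply]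
  ring

theorem structFn_inl (hT : T.IsAdaptedFrame ξ 𝒜 κ s)
    (hs : IsLocalFrameOn (𝓡 m) F ∞ s φ.source) {x : EuclideanSpace ℝ (Fin m)} (hx : x ∈ φ.target)
    (a b : ι) (i : Fin m) :
    (E.restrict φ hs).structFn x a b (κ (Sum.inl i)) = 0 := by
  have := structFn_restrict hT hs hx (κ.symm a) (κ.symm b) (Sum.inl i)
  simpa using this

theorem rho_inl (hT : T.IsAdaptedFrame ξ 𝒜 κ s)
    (hs : IsLocalFrameOn (𝓡 m) F ∞ s φ.source) {x : EuclideanSpace ℝ (Fin m)} (hx : x ∈ φ.target)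
    (i j : Fin m) : (E.restrict φ hs).rho x i (κ (Sum.inl j)) = if i = j then 1 else 0 := by
  rw [T.rho_restrict hs hx, hT _ (φ.map_target hx)]
  simp [frameHorizontal]

theorem rho_inr (hT : T.IsAdaptedFrame ξ 𝒜 κ s)
    (hs : IsLocalFrameOn (𝓡 m) F ∞ s φ.source) {x : EuclideanSpace ℝ (Fin m)} (hx : x ∈ φ.target)
    (i : Fin m) (B : Fin d) : (E.restrict φ hs).rho x i (κ (Sum.inr B)) = 0 := by
  rw [T.rho_restrict hs hx, hT _ (φ.map_target hx)]
  simp [frameHorizontal]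

end LieAlgebroid.AtiyahTrivialization

theorem structureConstant_skew {d : ℕ} {G : Type*} [TopologicalSpace G]
    [ChartedSpace (EuclideanSpace ℝ (Fin d)) G] [Group G] [LieGroup (𝓡 d) ∞ G]
    (ξ : Module.Basis (Fin d) ℝ (GroupLieAlgebra (𝓡 d) G)) (A B C : Fin d) :
    structureConstant ξ A B C = -structureConstant ξ B A C := by
  have := lieGroup_minSmoothness (d := d) (G := G)
  rw [structureConstant, ← lie_skew, map_neg]
  rfl

/-! ### From Euler–Lagrange to Lagrange–Poincaré and its two extreme cases -/

namespace LocalAlgebroid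

variable {m d : ℕ} {ι : Type*} [Fintype ι] [DecidableEq ι]

/-- Brackets of adapted sections are vertical, so only the vertical components of `Z` and `Y`
survive; with `Z = d/dt ∂L/∂z` and `Y = ∂L/∂y` this exhibits the common factor of the
Lagrange–Poincaré equations. -/
theorem sum_struct_eq (κ : Fin m ⊕ Fin d ≃ ι) (C : ι → ι → ℝ)
    (hC : ∀ b i, C b (κ (Sum.inl i)) = 0) (y Z Y : ι → ℝ) :
    ∑ b, ∑ c, C b c * y b * Z c - ∑ b, ∑ c, C b c * y b * Y c
      = ∑ A, (Z (κ (Sum.inr A)) - Y (κ (Sum.inr A))) *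
        (∑ i, C (κ (Sum.inl i)) (κ (Sum.inr A)) * y (κ (Sum.inl i))
          + ∑ D, C (κ (Sum.inr D)) (κ (Sum.inr A)) * y (κ (Sum.inr D))) := by
  simp only [← Finset.sum_sub_distrib, ← mul_sub]
  rw [Finset.sum_comm, ← κ.sum_comp, Fintype.sum_sum_type]
  simp only [hC, zero_mul, Finset.sum_const_zero, zero_add]
  refine Finset.sum_congr rfl fun A _ => ?_
  rw [← κ.sum_comp, Fintype.sum_sum_type, ← Finset.sum_mul, ← Finset.sum_mul]
  ring

theorem secondOrderEulerLagrange_iff_lagrangePoincare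
    (A : LocalAlgebroid (EuclideanSpace ℝ (Fin m)) (ι → ℝ))
    (L : (EuclideanSpace ℝ (Fin m) × (ι → ℝ)) × (ι → ℝ) → ℝ) (κ : Fin m ⊕ Fin d ≃ ι)
    (c : Fin d → Fin d → Fin d → ℝ) (𝒜 : EuclideanSpace ℝ (Fin m) → Fin m → Fin d → ℝ)
    (ℬ : EuclideanSpace ℝ (Fin m) → Fin m → Fin m → Fin d → ℝ) {U : Set (EuclideanSpace ℝ (Fin m))}
    (hskew : ∀ x ∈ U, A.IsSkewAt x) (hc : ∀ B D C, c B D C = -c D B C)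
    (hrho₁ : ∀ x ∈ U, ∀ i j, A.rho x i (κ (Sum.inl j)) = if i = j then 1 else 0)
    (hrho₂ : ∀ x ∈ U, ∀ i B, A.rho x i (κ (Sum.inr B)) = 0)
    (hvert : ∀ x ∈ U, ∀ a b i, A.structFn x a b (κ (Sum.inl i)) = 0)
    (h₁₁ : ∀ x ∈ U, ∀ i j C,
      A.structFn x (κ (Sum.inl i)) (κ (Sum.inl j)) (κ (Sum.inr C)) = -ℬ x i j C)
    (h₁₂ : ∀ x ∈ U, ∀ i B C, A.structFn x (κ (Sum.inl i)) (κ (Sum.inr B)) (κ (Sum.inr C))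
      = -∑ D, 𝒜 x i D * c D B C)
    (h₂₂ : ∀ x ∈ U, ∀ B D C,
      A.structFn x (κ (Sum.inr B)) (κ (Sum.inr D)) (κ (Sum.inr C)) = c B D C)
    {J : Set ℝ} {γ : ℝ → (EuclideanSpace ℝ (Fin m) × (ι → ℝ)) × (ι → ℝ)}
    (hγ : ∀ t ∈ J, (γ t).1.1 ∈ U) :
    A.SecondOrderEulerLagrange L J γ ↔
      LagrangePoincare (fun i => κ (Sum.inl i)) (fun B => κ (Sum.inr B)) c 𝒜 ℬ L J γ := by
  refine forall₂_congr fun t ht => ?_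
  have hU := hγ t ht
  have hlast : ∀ (P Q : ι → Prop), (∀ a, P a) ∧ (∀ a, Q a) ↔
      (∀ i, P (κ (Sum.inl i))) ∧ (∀ B, P (κ (Sum.inr B))) ∧
      (∀ i, Q (κ (Sum.inl i))) ∧ (∀ B, Q (κ (Sum.inr B))) := by
    intro P Q
    rw [← κ.forall_congr_right, ← κ.forall_congr_right (q := Q), Sum.forall, Sum.forall, and_assoc]
  rw [hlast]
  refine and_congr (forall_congr' fun i => ?_) (and_congr Iff.rfl (and_congr Iff.rfl
    (and_congr (forall_congr' fun j => ?_) (forall_congr' fun B => ?_))))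
  · rw [← κ.sum_comp, Fintype.sum_sum_type]
    simp [hrho₁ _ hU, hrho₂ _ hU]
  · have h := sum_struct_eq κ (A.structFn (γ t).1.1 (κ (Sum.inl j))) (hvert _ hU _)
      (γ t).1.2 (fun c => deriv (fun r => dLz L (γ r) c) t) (fun c => dLy L (γ t) c)
    have hB : ∀ i C, A.structFn (γ t).1.1 (κ (Sum.inl j)) (κ (Sum.inl i)) (κ (Sum.inr C))
        = ℬ (γ t).1.1 i j C := fun i C => by
      -- The free index `j` comes first in the structure function but second in `ℬ`; skew-symmetry
      -- cancels the sign.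
      rw [hskew _ hU, h₁₁ _ hU, neg_neg]
    have hA : ∀ D C, A.structFn (γ t).1.1 (κ (Sum.inl j)) (κ (Sum.inr D)) (κ (Sum.inr C))
        * (γ t).1.2 (κ (Sum.inr D))
        = ∑ B, c D B C * 𝒜 (γ t).1.1 j B * (γ t).1.2 (κ (Sum.inr D)) := fun D C => by
      rw [h₁₂ _ hU, ← Finset.sum_neg_distrib, Finset.sum_mul]
      refine Finset.sum_congr rfl fun B _ => ?_
      rw [hc D B C]
      ring
    have hx : ∑ i, A.rho (γ t).1.1 i (κ (Sum.inl j)) * dLx L (γ t) i = dLx L (γ t) j := by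
      simp [hrho₁ _ hU]
    simp only [hB, hA] at h
    rw [hx]
    constructor <;> intro h' <;> linarith
  · have h := sum_struct_eq κ (A.structFn (γ t).1.1 (κ (Sum.inr B))) (hvert _ hU _)
      (γ t).1.2 (fun c => deriv (fun r => dLz L (γ r) c) t) (fun c => dLy L (γ t) c)
    have hA : ∀ C, ∑ i, A.structFn (γ t).1.1 (κ (Sum.inr B)) (κ (Sum.inl i)) (κ (Sum.inr C))
        * (γ t).1.2 (κ (Sum.inl i))
        + ∑ D, A.structFn (γ t).1.1 (κ (Sum.inr B)) (κ (Sum.inr D)) (κ (Sum.inr C))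
          * (γ t).1.2 (κ (Sum.inr D))
        = -(∑ D, c D B C * (γ t).1.2 (κ (Sum.inr D))
          - ∑ D, ∑ i, c D B C * 𝒜 (γ t).1.1 i D * (γ t).1.2 (κ (Sum.inl i))) := fun C => by
      rw [neg_sub, sub_eq_add_neg, ← Finset.sum_neg_distrib, Finset.sum_comm (s := Finset.univ (α := Fin d))]
      congr 1
      · refine Finset.sum_congr rfl fun i _ => ?_
        rw [hskew _ hU, h₁₂ _ hU, neg_neg, Finset.sum_mul]
        refine Finset.sum_congr rfl fun D _ => ?_
        ring
      · refine Finset.sum_congr rfl fun D _ => ?_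
        rw [h₂₂ _ hU, hc B D C]
        ring
    have hx : ∑ i, A.rho (γ t).1.1 i (κ (Sum.inr B)) * dLx L (γ t) i = 0 := by
      simp [hrho₂ _ hU]
    simp only [hA, mul_neg, Finset.sum_neg_distrib] at h
    rw [hx]
    constructor <;> intro h' <;> linarith

theorem lagrangePoincare_iff_classical [IsEmpty (Fin d)] (h : Fin m → ι) (v : Fin d → ι)
    (c : Fin d → Fin d → Fin d → ℝ) (𝒜 : EuclideanSpace ℝ (Fin m) → Fin m → Fin d → ℝ)
    (ℬ : EuclideanSpace ℝ (Fin m) → Fin m → Fin m → Fin d → ℝ)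
    (L : (EuclideanSpace ℝ (Fin m) × (ι → ℝ)) × (ι → ℝ) → ℝ) (J : Set ℝ)
    (γ : ℝ → (EuclideanSpace ℝ (Fin m) × (ι → ℝ)) × (ι → ℝ)) :
    LagrangePoincare h v c 𝒜 ℬ L J γ ↔ ClassicalEulerLagrange h L J γ := by
  refine forall₂_congr fun t _ => and_congr Iff.rfl (and_congr Iff.rfl ?_)
  simp only [IsEmpty.forall_iff, Finset.univ_eq_empty, Finset.sum_empty, true_and, and_true,
    neg_zero]
  refine forall_congr' fun i => ?_
  constructor <;> intro h' <;> linarith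

/-- Only the vertical equations remain, and the two forms differ by exchanging the lower indices of
`c` and moving the sum to the other side. -/
theorem lagrangePoincare_iff_eulerPoincare [IsEmpty (Fin m)] (h : Fin m → ι) (v : Fin d → ι)
    {c : Fin d → Fin d → Fin d → ℝ} (hc : ∀ B D C, c B D C = -c D B C)
    (𝒜 : EuclideanSpace ℝ (Fin m) → Fin m → Fin d → ℝ)
    (ℬ : EuclideanSpace ℝ (Fin m) → Fin m → Fin m → Fin d → ℝ)
    (L : (EuclideanSpace ℝ (Fin m) × (ι → ℝ)) × (ι → ℝ) → ℝ) (J : Set ℝ)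
    (γ : ℝ → (EuclideanSpace ℝ (Fin m) × (ι → ℝ)) × (ι → ℝ)) :
    LagrangePoincare h v c 𝒜 ℬ L J γ ↔ EulerPoincare v c L J γ := by
  refine forall₂_congr fun t _ => ?_
  simp only [IsEmpty.forall_iff, Finset.univ_eq_empty, Finset.sum_empty, true_and,
    Finset.sum_const_zero, sub_zero]
  refine and_congr Iff.rfl (forall_congr' fun B => ?_)
  have key : ∑ A, (deriv (fun r => dLz L (γ r) (v A)) t - dLy L (γ t) (v A)) *
      ∑ D, c D B A * (γ t).1.2 (v D)
      = ∑ D, ∑ A, c B D A * (γ t).1.2 (v D) * dLy L (γ t) (v A)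
        - ∑ D, ∑ A, c B D A * (γ t).1.2 (v D) * deriv (fun r => dLz L (γ r) (v A)) t := by
    simp only [Finset.mul_sum, ← Finset.sum_sub_distrib]
    rw [Finset.sum_comm]
    refine Finset.sum_congr rfl fun D _ => Finset.sum_congr rfl fun A _ => ?_
    rw [hc D B A]
    ring
  rw [key]
  constructor <;> intro h' <;> linarith

end LocalAlgebroid

end

/-! ### The theorem -/

open LocalAlgebroid in
theorem mainTheorem3 {m : ℕ} {M : Type*} [TopologicalSpace M] [T2Space M]
    [ChartedSpace (EuclideanSpace ℝ (Fin m)) M] [IsManifold (𝓡 m) ∞ M]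
    {F : Type*} [NormedAddCommGroup F] [NormedSpace ℝ F]
    {V : M → Type*} [TopologicalSpace (TotalSpace F V)]
    [∀ x, AddCommGroup (V x)] [∀ x, Module ℝ (V x)] [∀ x, TopologicalSpace (V x)]
    [FiberBundle F V] [VectorBundle ℝ F V] [ContMDiffVectorBundle ∞ F V (𝓡 m)]
    (E : LieAlgebroid m F V)
    {φ : OpenPartialHomeomorph M (EuclideanSpace ℝ (Fin m))}
    (hφ : φ ∈ IsManifold.maximalAtlas (𝓡 m) ∞ M)
    {ι : Type*} [Fintype ι] [DecidableEq ι]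
    {s : ι → (x : M) → V x} (hs : IsLocalFrameOn (𝓡 m) F ∞ s φ.source)
    (L : E.Admissible → ℝ)
    (hL : ContDiffOn ℝ ∞ (E.lagrangianCoord hφ hs L) {q | q.1.1 ∈ φ.target}) :
    -- the solutions `X` of `i_X Ω₀ = dH`, point by point
    (∀ w : PontryaginSpace (EuclideanSpace ℝ (Fin m)) (ι → ℝ), w.1.1 ∈ φ.target →
      ∀ X : PontryaginFiber (ι → ℝ),
        (E.restrict φ hs).SolvesAt (E.lagrangianCoord hφ hs L) w X ↔
          (∀ a, X.1.1 a = w.1.2 a) ∧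
          (∀ a, X.1.2 a = w.2.1 a) ∧
          (∀ a, X.2.2 (Pi.single a 1, 0) =
            ∑ i, (E.restrict φ hs).rho w.1.1 i a
                * dLx (E.lagrangianCoord hφ hs L) (w.1, w.2.1) i
              - ∑ b, ∑ c, (E.restrict φ hs).structFn w.1.1 a b c * mom w c * w.1.2 b) ∧
          (∀ a, X.2.2 (0, Pi.single a 1) =
            -mom w a + dLy (E.lagrangianCoord hφ hs L) (w.1, w.2.1) a) ∧
          (∀ a, momBar w a = dLz (E.lagrangianCoord hφ hs L) (w.1, w.2.1) a)) ∧
    -- the integral curves of a solution `X` defined along a subset `S` of `W₀`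
    (∀ (S : Set (PontryaginSpace (EuclideanSpace ℝ (Fin m)) (ι → ℝ)))
      (X : PontryaginSpace (EuclideanSpace ℝ (Fin m)) (ι → ℝ) → PontryaginFiber (ι → ℝ)),
      (∀ w ∈ S, w.1.1 ∈ φ.target) →
      (∀ w ∈ S, (E.restrict φ hs).SolvesAt (E.lagrangianCoord hφ hs L) w (X w)) →
      ∀ (J : Set ℝ) (w : ℝ → PontryaginSpace (EuclideanSpace ℝ (Fin m)) (ι → ℝ)),
        (∀ t ∈ J, w t ∈ S ∧
          HasDerivAt w ((E.restrict φ hs).pontryagin.anchor (w t) (X (w t))) t) →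
        (E.restrict φ hs).MomentumEquations (E.lagrangianCoord hφ hs L) J w) ∧
    -- a smooth curve is a solution curve exactly if it satisfies the equations with momenta
    (∀ (J : Set ℝ) (w : ℝ → PontryaginSpace (EuclideanSpace ℝ (Fin m)) (ι → ℝ)), IsOpen J →
      ContDiffOn ℝ ∞ w J → (∀ t ∈ J, (w t).1.1 ∈ φ.target) →
        ((E.restrict φ hs).IsSolutionCurve (E.lagrangianCoord hφ hs L) J w ↔
          (E.restrict φ hs).MomentumEquations (E.lagrangianCoord hφ hs L) J w)) ∧
    -- elimination of the momenta
    (∀ (J : Set ℝ) (γ : ℝ → (EuclideanSpace ℝ (Fin m) × (ι → ℝ)) × (ι → ℝ)), IsOpen J →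
      ContDiffOn ℝ ∞ γ J → (∀ t ∈ J, (γ t).1.1 ∈ φ.target) →
        ((∃ α : ℝ → ((ι → ℝ) × (ι → ℝ)) →L[ℝ] ℝ, ContDiffOn ℝ ∞ α J ∧
            (E.restrict φ hs).MomentumEquations (E.lagrangianCoord hφ hs L) J
              (fun t => ((γ t).1, ((γ t).2, α t)))) ↔
          (E.restrict φ hs).SecondOrderEulerLagrange (E.lagrangianCoord hφ hs L) J γ) ∧
        (∀ α : ℝ → ((ι → ℝ) × (ι → ℝ)) →L[ℝ] ℝ, ContDiffOn ℝ ∞ α J →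
          ((E.restrict φ hs).MomentumEquations (E.lagrangianCoord hφ hs L) J
              (fun t => ((γ t).1, ((γ t).2, α t))) ↔
            (E.restrict φ hs).SecondOrderEulerLagrange (E.lagrangianCoord hφ hs L) J γ ∧
            ∀ t ∈ J, ∀ a,
              α t (0, Pi.single a 1) = dLz (E.lagrangianCoord hφ hs L) (γ t) a ∧
              α t (Pi.single a 1, 0) = dLy (E.lagrangianCoord hφ hs L) (γ t) a
                - deriv (fun r => dLz (E.lagrangianCoord hφ hs L) (γ r) a) t))) ∧
    -- the Atiyah case, in the frame `ê_i = ∂/∂x^i - 𝒜^A_i ξ_A`, `ê_B = ξ_B`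
    (∀ (d : ℕ) (G : Type*) [TopologicalSpace G] [ChartedSpace (EuclideanSpace ℝ (Fin d)) G]
      [Group G] [LieGroup (𝓡 d) ∞ G] (T : E.AtiyahTrivialization φ d G)
      (ξ : Module.Basis (Fin d) ℝ (GroupLieAlgebra (𝓡 d) G))
      (𝒜 : PrincipalConnection φ.target d G) (κ : Fin m ⊕ Fin d ≃ ι),
      (∀ x ∈ φ.source, ∀ i, T.toFun x (s (κ (Sum.inl i)) x)
        = (EuclideanSpace.single i 1, -𝒜.value (φ x) i)) →
      (∀ x ∈ φ.source, ∀ B, T.toFun x (s (κ (Sum.inr B)) x) = (0, ξ B)) →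
      ∀ (J : Set ℝ) (γ : ℝ → (EuclideanSpace ℝ (Fin m) × (ι → ℝ)) × (ι → ℝ)), IsOpen J →
      ContDiffOn ℝ ∞ γ J → (∀ t ∈ J, (γ t).1.1 ∈ φ.target) →
        ((E.restrict φ hs).SecondOrderEulerLagrange (E.lagrangianCoord hφ hs L) J γ ↔
          LagrangePoincare (fun i => κ (Sum.inl i)) (fun B => κ (Sum.inr B))
            (structureConstant ξ) (𝒜.coeff ξ) (𝒜.curvature ξ) (E.lagrangianCoord hφ hs L) J γ) ∧
        -- trivial structure group: the classical second-order Euler–Lagrange equations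
        (d = 0 →
          (LagrangePoincare (fun i => κ (Sum.inl i)) (fun B => κ (Sum.inr B))
            (structureConstant ξ) (𝒜.coeff ξ) (𝒜.curvature ξ) (E.lagrangianCoord hφ hs L) J γ ↔
          ClassicalEulerLagrange (fun i => κ (Sum.inl i)) (E.lagrangianCoord hφ hs L) J γ)) ∧
        -- the group itself, over a point: the second-order Euler–Poincaré equations
        (m = 0 →
          (LagrangePoincare (fun i => κ (Sum.inl i)) (fun B => κ (Sum.inr B))
            (structureConstant ξ) (𝒜.coeff ξ) (𝒜.curvature ξ) (E.lagrangianCoord hφ hs L) J γ ↔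
          EulerPoincare (fun B => κ (Sum.inr B)) (structureConstant ξ)
            (E.lagrangianCoord hφ hs L) J γ))) := by
  have hΩ : IsOpen {q : (EuclideanSpace ℝ (Fin m) × (ι → ℝ)) × (ι → ℝ) | q.1.1 ∈ φ.target} :=
    φ.open_target.preimage (continuous_fst.comp continuous_fst)
  -- The coordinate Lagrangian has the default value `0` off the chart domain, so it is
  -- differentiated only over the open set `φ.target`.
  have hdiff : ∀ q : (EuclideanSpace ℝ (Fin m) × (ι → ℝ)) × (ι → ℝ), q.1.1 ∈ φ.target →
      DifferentiableAt ℝ (E.lagrangianCoord hφ hs L) q := fun q hq =>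
    (hL.contDiffAt (hΩ.mem_nhds hq)).differentiableAt (by simp)
  have hskew := E.isSkewAt_restrict hs
  refine ⟨fun w hw X => solvesAt_iff_coordinates _ (hskew _) (hdiff _ hw) X, ?_, ?_, ?_, ?_⟩
  · intro S X hS hX J w hw
    exact (isSolutionCurve_iff _ (fun _ _ => hskew _) (fun t ht => hdiff _ (hS _ (hw t ht).1))
      (fun t ht => (hw t ht).2.differentiableAt)).mp
        ⟨fun t => X (w t), fun t ht => ⟨hX _ (hw t ht).1, (hw t ht).2⟩⟩
  · intro J w hJ hw hmem
    exact isSolutionCurve_iff _ (fun _ _ => hskew _) (fun t ht => hdiff _ (hmem t ht))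
      (fun t ht => differentiableAt_of_contDiffOn hJ hw ht)
  · intro J γ hJ hγ hmem
    exact ⟨exists_momenta_iff _ hΩ hL hJ hγ hmem,
      fun α _ => momentumEquations_iff _ hΩ hL hJ hγ hmem α⟩
  · intro d G _ _ _ _ T ξ 𝒜 κ hh hv J γ hJ hγ hmem
    have hT : T.IsAdaptedFrame ξ 𝒜 κ s := by
      rintro x hx (i | B)
      exacts [hh x hx i, hv x hx B]
    refine ⟨?_, ?_, ?_⟩
    · exact secondOrderEulerLagrange_iff_lagrangePoincare _ _ κ _ _ _ (fun x _ => hskew x)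
        (structureConstant_skew ξ)
        (fun x hx => LieAlgebroid.AtiyahTrivialization.rho_inl hT hs hx)
        (fun x hx => LieAlgebroid.AtiyahTrivialization.rho_inr hT hs hx)
        (fun x hx => LieAlgebroid.AtiyahTrivialization.structFn_inl hT hs hx)
        (fun x hx => LieAlgebroid.AtiyahTrivialization.structFn_inl_inl hT hs hx)
        (fun x hx => LieAlgebroid.AtiyahTrivialization.structFn_inl_inr hT hs hx)
        (fun x hx => LieAlgebroid.AtiyahTrivialization.structFn_inr_inr hT hs hx) hmem
    · intro hd
      have : IsEmpty (Fin d) := by subst hd; infer_instance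
      exact lagrangePoincare_iff_classical _ _ _ _ _ _ _ _
    · intro hm
      have : IsEmpty (Fin m) := by subst hm; infer_instance
      exact lagrangePoincare_iff_eulerPoincare _ _ (structureConstant_skew ξ) _ _ _ _ _
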